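/- **Setting.** For a symmetric positive definite $\Sigma\in\mathbb R^{d\times d}$ and $K>0$, write $X\sim subG_K(\Sigma)$ if $\mathbb E[XX^T]=\Sigma$ and $\mathbb E\exp\!\big(\langle u,X\rangle^2/(K^2u^T\Sigma u)\big)\le 2$ for all $u\neq 0$ in $\mathbb R^d$ (no centering is assumed). Let $d,n_\xi\ge 1$, $0<\eta<1$, $\lambda\ge 0$, $\mu>0$. Let the private data $\xi_1,\dots,\xi_{n_\xi}\in\mathbb R^d$ be i.i.d. $\sim subG_K(\Sigma)$ and the public data $\upsilon_1,\dots,\upsilon_{n_\upsilon}\in\mathbb R^d$ be i.i.d. $\sim subG_K(\Sigma)$, and put $$\hat\Sigma_\xi=\tfrac1{n_\xi}\sum_i\xi_i\xi_i^T,\qquad \hat\Sigma_\upsilon=\tfrac1{n_\upsilon}\sum_i\upsilon_i\upsilon_i^T .$$ Public-moment-guided truncation (PMT) with truncation constant $\tau$ replaces $\xi_i$ by $\tilde\xi_i$, obtained from $\hat\Sigma_\upsilon^{-1/2}\xi_i$ by radial truncation at radius $R=\sqrt{\tau d\,(1+\log(2n_\xi/\eta))}$: a vector $x$ with $\|x\|_2\ge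 R$ becomes $Rx/\|x\|_2$, and any other vector is unchanged. Let $\tilde\Sigma_\xi=\frac1{n_\xi}\sum_i\tilde\xi_i\tilde\xi_i^T$. Let $\mathbf G$ be a symmetric Gaussian random matrix whose entries on and above the diagonal are independent $\mathcal N(0,\sigma^2)$ with $$\sigma=\frac{2R^2}{\mu n_\xi}=\frac{2\tau d\,(1+\log(2n_\xi/\eta))}{\mu n_\xi}.$$ Matrix norms are spectral norms, and $a_+=\max(a,0)$. **Theorem.** For every $K>0$ there is a constant $C>0$ depending only on $K$ such that the following holds for all $d,n_\xi,n_\upsilon,\eta,\lambda,\mu,\Sigma$ and all data as above, whenever $\tau\ge C$ and $\sqrt{n_\upsilon}\ge C(\sqrt d+\sqrt{\log(1/\eta)})$. Put $$L=\frac{n_\upsilon}{\big(\sqrt{n_\upsilon}+C(\sqrt d+\sqrt{\log(1/\eta)})\big)^2},\qquad b=\Big(1-C\Big(\sqrt{\tfrac d{n_\xi}}+\sqrt{\tfrac{\log(1/\eta)}{n_\xi}}\Big)\Big)_+,\qquad r=\frac{\sqrt{d^3\log(2d/\eta)}\,\big(1+\log(2n_\xi/\eta)\big)}{\mu n_\xi}.$$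 **1. Recovery.** With probability at least $1-C\eta$, $\hat\Sigma_\upsilon$ is positive definite and $$\hat\Sigma_\upsilon^{1/2}\big(\tilde\Sigma_\xi+\lambda\hat\Sigma_\upsilon^{-1}\big)\hat\Sigma_\upsilon^{1/2}=\hat\Sigma_\xi+\lambda\mathbf I .$$ **2. Inverse error.** Consider the sample-size condition $$L b^2+\lambda\|\hat\Sigma_\upsilon\|^{-1}>0,\qquad \frac{C\tau\, r}{L b^2+\lambda\|\hat\Sigma_\upsilon\|^{-1}}\le\frac12 .\tag{$*$}$$ (a) Except on an event of probability at most $C\eta$, $(*)$ implies that $\hat\Sigma_\upsilon$, $\tilde\Sigma_\xi+\lambda\hat\Sigma_\upsilon^{-1}$ and $\tilde\Sigma_\xi+\lambda\hat\Sigma_\upsilon^{-1}+\mathbf G$ are invertible and $$\big\|(\tilde\Sigma_\xi+\lambda\hat\Sigma_\upsilon^{-1}+\mathbf G)^{-1}-(\tilde\Sigma_\xi+\lambda\hat\Sigma_\upsilon^{-1})^{-1}\big\|\le\frac{C\tau\, r}{L^2b^4+\lambda^2\|\hat\Sigma_\upsilon\|^{-2}} .$$ (b) Except on an event of probability at most $C\eta$,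 $(*)$ implies that $\hat\Sigma_\upsilon$, $\hat\Sigma_\xi+\lambda\mathbf I$ and $\tilde\Sigma_\xi+\lambda\hat\Sigma_\upsilon^{-1}+\mathbf G$ are invertible and $$\big\|\hat\Sigma_\upsilon^{-1/2}(\tilde\Sigma_\xi+\lambda\hat\Sigma_\upsilon^{-1}+\mathbf G)^{-1}\hat\Sigma_\upsilon^{-1/2}-(\hat\Sigma_\xi+\lambda\mathbf I)^{-1}\big\|\le\frac{C\tau\, r\,\|\hat\Sigma_\upsilon^{-1}\|}{L^2b^4+\lambda^2\|\hat\Sigma_\upsilon\|^{-2}} .$$ -/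

import Mathlib

open MeasureTheory ProbabilityTheory Matrix
open scoped Matrix.Norms.L2Operator MatrixOrder

universe u

noncomputable section

/-- `X` is a sub-Gaussian random vector with second-moment matrix `S` and sub-Gaussian constant `K`:
`E[X Xᵀ] = S`, and every one-dimensional marginal `⟨u, X⟩` has `ψ₂`-norm at most
`K (uᵀ S u)^{1/2}`, that is, `E exp (⟨u, X⟩² / (K² uᵀ S u)) ≤ 2`.
No centering is assumed. For invertible `S` this says that `S^{-1/2} X` is isotropic with
`ψ₂`-norm at most `K`. -/
structure IsSubG {Ω : Type*} [MeasurableSpace Ω] (P : Measure Ω) {d : ℕ} (K : ℝ)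
    (S : Matrix (Fin d) (Fin d) ℝ) (X : Ω → EuclideanSpace ℝ (Fin d)) : Prop where
  memLp : MemLp X 2 P
  second_moment : ∀ i j, ∫ ω, X ω i * X ω j ∂P = S i j
  psi2_le : ∀ u : EuclideanSpace ℝ (Fin d),
    ∫⁻ ω, ENNReal.ofReal
      (Real.exp ((inner ℝ u (X ω)) ^ 2 / (K ^ 2 * (u.ofLp ⬝ᵥ (S *ᵥ u.ofLp))))) ∂P ≤ 2

/-- `X 0, …, X (n-1)` are i.i.d. draws from a distribution in `subG(S)` with constant `K`. -/
structure IsIIDSubG {Ω : Type*} [MeasurableSpace Ω] (P : Measure Ω) {d n : ℕ} (K : ℝ)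
    (S : Matrix (Fin d) (Fin d) ℝ) (X : Fin n → Ω → EuclideanSpace ℝ (Fin d)) : Prop where
  indep : iIndepFun X P
  identDistrib : ∀ i j, IdentDistrib (X i) (X j) P P
  subG : ∀ i, IsSubG P K S (X i)

/-- `G` is a symmetric Gaussian random matrix `SG_d(σ²)`: symmetric, with independent
`N(0, σ²)` entries on and above the diagonal. -/
structure IsSymmGaussian {Ω : Type*} [MeasurableSpace Ω] (P : Measure Ω) {d : ℕ} (σ : ℝ)
    (G : Ω → Matrix (Fin d) (Fin d) ℝ) : Prop where
  symm : ∀ᵐ ω ∂P, (G ω).IsSymm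
  law : ∀ i j, i ≤ j → HasLaw (fun ω => G ω i j) (gaussianReal 0 (σ ^ 2).toNNReal) P
  indep : iIndepFun (fun (p : {p : Fin d × Fin d // p.1 ≤ p.2}) ω => G ω p.1.1 p.1.2) P

/-- The sample second-moment matrix `(1/n) ∑ xᵢ xᵢᵀ`. -/
def secondMoment {d n : ℕ} (x : Fin n → EuclideanSpace ℝ (Fin d)) :
    Matrix (Fin d) (Fin d) ℝ :=
  (1 / (n : ℝ)) • ∑ i, vecMulVec (x i).ofLp (x i).ofLp

/-- `S^{1/2}`, the positive semidefinite square root. -/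
def sqrtM {d : ℕ} (S : Matrix (Fin d) (Fin d) ℝ) : Matrix (Fin d) (Fin d) ℝ := CFC.sqrt S

/-- `S^{-1/2}` (meaningful for positive definite `S`). -/
def invSqrtM {d : ℕ} (S : Matrix (Fin d) (Fin d) ℝ) : Matrix (Fin d) (Fin d) ℝ := (sqrtM S)⁻¹

/-- Radial truncation at radius `R`. -/
def truncate {d : ℕ} (R : ℝ) (x : EuclideanSpace ℝ (Fin d)) : EuclideanSpace ℝ (Fin d) :=
  if R ≤ ‖x‖ then (R / ‖x‖) • x else x

/-- The truncation radius `(τ d (1 + log (2 n / η)))^{1/2}`, with truncation constant `τ`. -/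
def pmtRadius (τ : ℝ) (d n : ℕ) (η : ℝ) : ℝ :=
  √(τ * (d * (1 + Real.log (2 * n / η))))

/-- Public-moment-guided truncation: each `xᵢ` is mapped to `S^{-1/2} xᵢ`, which is then truncated
at `pmtRadius`; `S` is the public second-moment matrix. -/
def pmt {d n : ℕ} (τ η : ℝ) (S : Matrix (Fin d) (Fin d) ℝ)
    (x : Fin n → EuclideanSpace ℝ (Fin d)) : Fin n → EuclideanSpace ℝ (Fin d) :=
  fun i => truncate (pmtRadius τ d n η) (WithLp.toLp 2 (invSqrtM S *ᵥ (x i).ofLp))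

/-- The noise level `2 τ d (1 + log (2 n / η)) / (μ n)` of the Gaussian mechanism: twice the squared
truncation radius over `μ n`. -/
def noiseScale (τ : ℝ) (d n : ℕ) (η μ : ℝ) : ℝ :=
  2 * τ * d * (1 + Real.log (2 * n / η)) / (μ * n)

/-- `√d + √(log (1/η))`. -/
def devTerm (d : ℕ) (η : ℝ) : ℝ := √(d : ℝ) + √(Real.log (1 / η))

/-- `L = m / (√m + C (√d + √(log (1/η))))²`. -/
def lowerL (C : ℝ) (d m : ℕ) (η : ℝ) : ℝ := m / (√(m : ℝ) + C * devTerm d η) ^ 2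

/-- The positive part of `1 - C (√(d/n) + √(log (1/η) / n))`. -/
def shrink (C : ℝ) (d n : ℕ) (η : ℝ) : ℝ :=
  max 0 (1 - C * (√((d : ℝ) / n) + √(Real.log (1 / η) / n)))

/-- `√(d³ log (2d/η)) (1 + log (2n/η)) / (μ n)`. -/
def noiseRate (d n : ℕ) (η μ : ℝ) : ℝ :=
  √((d : ℝ) ^ 3 * Real.log (2 * d / η)) * (1 + Real.log (2 * n / η)) / (μ * n)

/-- `L (1 - C(…))₊² + lam ‖S‖⁻¹`, with the spectral norm. -/
def stabDenom {d : ℕ} (C : ℝ) (n m : ℕ) (η lam : ℝ) (S : Matrix (Fin d) (Fin d) ℝ) : ℝ :=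
  lowerL C d m η * shrink C d n η ^ 2 + lam * ‖S‖⁻¹

/-- `L² (1 - C(…))₊⁴ + lam² ‖S‖⁻²`, with the spectral norm. -/
def errDenom {d : ℕ} (C : ℝ) (n m : ℕ) (η lam : ℝ) (S : Matrix (Fin d) (Fin d) ℝ) : ℝ :=
  lowerL C d m η ^ 2 * shrink C d n η ^ 4 + lam ^ 2 * (‖S‖⁻¹) ^ 2

/-- The private sample-size condition. -/
def StableCond {d : ℕ} (C τ : ℝ) (n m : ℕ) (η μ lam : ℝ) (S : Matrix (Fin d) (Fin d) ℝ) : Prop :=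
  0 < stabDenom C n m η lam S ∧ C * τ * noiseRate d n η μ / stabDenom C n m η lam S ≤ 1 / 2

/-- The regularized transformed second-moment matrix `Σ̃ + lam S⁻¹` of the private data `x`, with
public second-moment matrix `S`. -/
def regTransformed {d n : ℕ} (τ η lam : ℝ) (S : Matrix (Fin d) (Fin d) ℝ)
    (x : Fin n → EuclideanSpace ℝ (Fin d)) : Matrix (Fin d) (Fin d) ℝ :=
  secondMoment (pmt τ η S x) + lam • S⁻¹

end

/-! Write A for the public second-moment matrix and S for the population one. Bernstein's inequality
for squared marginals and a union bound over a sphere net (`measure_not_secondMoment_close`) compare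
each sample second-moment form with that of S multiplicatively. For the public sample this gives S ≤
2A and A ≤ (1 + Cδ)²S, with δ = (√d + √log(1/η))/√m for public sample size m.

Recovery: the forms of S⁻¹ at all private points are below dK² log(2n/η) with high probability.
Since inversion is antitone (`qf_inv_le_of_qf_le`), whitening by A at most doubles them, so for
large τ no point is truncated and the transformed matrix W is exactly the congruence A^{-1/2}(B +
lam·1)A^{-1/2}, where B is the private second-moment matrix.

Inverse error: the same comparisons make W coercive with constant `stabDenom`
(`stabDenom_mul_le_qf`). The Gaussian norm is at most 16τ times `noiseRate`, so the sample-size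
condition keeps W + G coercive and the resolvent identity bounds the difference of inverses
(`stable_inverse_bound`). Undoing the congruence costs ‖A⁻¹‖. Only union bounds join the events, so
no independence between private data, public data and noise enters. -/

/-- The quadratic form `x ↦ xᵀ M x`. -/
def qf {d : ℕ} (M : Matrix (Fin d) (Fin d) ℝ) (x : Fin d → ℝ) : ℝ := x ⬝ᵥ (M *ᵥ x)

/-! ### Quadratic forms and nets of the sphere -/

section QuadraticForm

variable {d : ℕ}

lemma norm_toLp_sq (x : Fin d → ℝ) : ‖(WithLp.toLp 2 x : EuclideanSpace ℝ (Fin d))‖ ^ 2 = x ⬝ᵥ x := by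
  rw [EuclideanSpace.norm_sq_eq]
  simp [dotProduct, pow_two]

lemma dotProduct_self_nonneg_real (x : Fin d → ℝ) : 0 ≤ x ⬝ᵥ x := by
  rw [← norm_toLp_sq]; positivity

lemma qf_smul (M : Matrix (Fin d) (Fin d) ℝ) (c : ℝ) (x : Fin d → ℝ) :
    qf M (c • x) = c ^ 2 * qf M x := by
  simp only [qf, mulVec_smul, smul_dotProduct, dotProduct_smul, smul_eq_mul]; ring

/-- Along the line z + s·w the form is a nonnegative quadratic in s without constant term, so its
linear coefficient vanishes. Symmetry of M plays no role. -/
lemma qf_sub_eq_of_isotropic {M : Matrix (Fin d) (Fin d) ℝ} (hM : ∀ v, 0 ≤ qf M v)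
    {z : Fin d → ℝ} (hz : qf M z = 0) (w : Fin d → ℝ) : qf M (z - w) = qf M w := by
  have hexp : ∀ s : ℝ, qf M (z + s • w) =
      s * (z ⬝ᵥ (M *ᵥ w) + w ⬝ᵥ (M *ᵥ z)) + s ^ 2 * qf M w := fun s => by
    have : qf M (z + s • w) = qf M z + s * (z ⬝ᵥ (M *ᵥ w) + w ⬝ᵥ (M *ᵥ z)) + s ^ 2 * qf M w := by
      simp only [qf, mulVec_add, mulVec_smul, add_dotProduct, dotProduct_add, smul_dotProduct,
        dotProduct_smul, smul_eq_mul]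
      ring
    rw [this, hz, zero_add]
  set b := z ⬝ᵥ (M *ᵥ w) + w ⬝ᵥ (M *ᵥ z)
  have hc := hM w
  have hb : b = 0 := by
    -- The +1 avoids dividing by zero when the form vanishes at w; the value at this s is minus a
    -- square.
    have h1 := hM (z + (-b / (qf M w + 1)) • w)
    rw [hexp, show -b / (qf M w + 1) * b + (-b / (qf M w + 1)) ^ 2 * qf M w =
      -(b / (qf M w + 1)) ^ 2 by field_simp; ring, neg_nonneg] at h1
    have h2 : b / (qf M w + 1) = 0 := pow_eq_zero_iff two_ne_zero |>.1 (le_antisymm h1 (sq_nonneg _))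
    exact (div_eq_zero_iff.1 h2).resolve_right (by positivity)
  have := hexp (-1)
  rw [hb] at this
  simpa [sub_eq_add_neg] using this

lemma qf_one (x : Fin d → ℝ) : qf (1 : Matrix (Fin d) (Fin d) ℝ) x = x ⬝ᵥ x := by simp [qf]

lemma qf_add (M N : Matrix (Fin d) (Fin d) ℝ) (x : Fin d → ℝ) :
    qf (M + N) x = qf M x + qf N x := by simp [qf, add_mulVec, dotProduct_add]

lemma qf_sub (M N : Matrix (Fin d) (Fin d) ℝ) (x : Fin d → ℝ) :
    qf (M - N) x = qf M x - qf N x := by simp [qf, sub_mulVec, dotProduct_sub]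

lemma qf_smul_left (c : ℝ) (M : Matrix (Fin d) (Fin d) ℝ) (x : Fin d → ℝ) :
    qf (c • M) x = c * qf M x := by simp [qf, smul_mulVec, dotProduct_smul]

lemma continuous_qf (M : Matrix (Fin d) (Fin d) ℝ) : Continuous (qf M) := by
  unfold qf; fun_prop

/-- The unit sphere of `ℝ^d` has a `1/2`-net with at most `5^d` points. -/
lemma exists_sphere_net (d : ℕ) : ∃ N : Finset (Fin d → ℝ), N.card ≤ 5 ^ d ∧
    (∀ y ∈ N, y ⬝ᵥ y = 1) ∧
    ∀ x : Fin d → ℝ, x ⬝ᵥ x = 1 → ∃ y ∈ N, (x - y) ⬝ᵥ (x - y) ≤ 1 / 4 := by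
  classical
  let good : Finset (Fin d → ℝ) → Prop := fun N => (∀ y ∈ N, y ⬝ᵥ y = 1) ∧
    ∀ x ∈ N, ∀ y ∈ N, x ≠ y → 1 / 4 ≤ (x - y) ⬝ᵥ (x - y)
  -- Doubling turns 1/2-separated unit vectors into 1-separated points of the ball of radius 2,
  -- where the Besicovitch packing bound applies.
  have hcard : ∀ N, good N → N.card ≤ 5 ^ d := by
    rintro N ⟨h1, h2⟩
    let e : (Fin d → ℝ) → EuclideanSpace ℝ (Fin d) := fun x => (2 : ℝ) • WithLp.toLp 2 x
    have he : Function.Injective e := fun x y h => by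
      simpa [e] using h
    have key := Besicovitch.card_le_of_separated (N.image e) ?_ ?_
    · rwa [Finset.card_image_of_injective _ he, finrank_euclideanSpace_fin] at key
    · intro c hc
      obtain ⟨x, hx, rfl⟩ := Finset.mem_image.1 hc
      have := norm_toLp_sq x
      rw [h1 x hx] at this
      simp only [e, norm_smul, Real.norm_eq_abs]
      have h3 : ‖(WithLp.toLp 2 x : EuclideanSpace ℝ (Fin d))‖ = 1 := by
        nlinarith [norm_nonneg (WithLp.toLp 2 x : EuclideanSpace ℝ (Fin d))]
      rw [h3]; norm_num
    · intro c hc c' hc' hne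
      obtain ⟨x, hx, rfl⟩ := Finset.mem_image.1 hc
      obtain ⟨y, hy, rfl⟩ := Finset.mem_image.1 hc'
      have h3 := h2 x hx y hy (fun h => hne (by rw [h]))
      rw [← norm_toLp_sq] at h3
      have h4 : e x - e y = (2 : ℝ) • (WithLp.toLp 2 (x - y) : EuclideanSpace ℝ (Fin d)) := by
        simp [e, smul_sub]
      rw [h4, norm_smul, Real.norm_eq_abs, abs_of_pos two_pos]
      nlinarith [norm_nonneg (WithLp.toLp 2 (x - y) : EuclideanSpace ℝ (Fin d))]
  -- A separated set of maximal cardinality is a net: an uncovered point could be added to it.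
  let A : Set ℕ := {n | ∃ N, good N ∧ N.card = n}
  have hA : A.Nonempty := ⟨0, ∅, ⟨by simp, by simp⟩, rfl⟩
  have hB : BddAbove A := ⟨5 ^ d, by rintro _ ⟨N, hN, rfl⟩; exact hcard N hN⟩
  obtain ⟨N, hN, hNc⟩ := Nat.sSup_mem hA hB
  refine ⟨N, hcard N hN, hN.1, fun x hx => ?_⟩
  by_contra! hcon
  have hxN : x ∉ N := fun h => by
    have := hcon x h
    simp at this
    linarith
  have hgood : good (insert x N) := by
    refine ⟨fun y hy => ?_, fun a ha b hb hab => ?_⟩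
    · rcases Finset.mem_insert.1 hy with rfl | h
      exacts [hx, hN.1 y h]
    · rcases Finset.mem_insert.1 ha with rfl | ha' <;> rcases Finset.mem_insert.1 hb with rfl | hb'
      · exact absurd rfl hab
      · exact (hcon b hb').le
      · rw [← neg_sub, neg_dotProduct_neg]; exact (hcon a ha').le
      · exact hN.2 a ha' b hb' hab
  have := le_csSup hB ⟨_, hgood, Finset.card_insert_of_notMem hxN⟩
  omega

/-- A quadratic form bounded on a `1/2`-net of the sphere is bounded on the whole sphere. -/
lemma abs_qf_le_of_net {N : Finset (Fin d → ℝ)}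
    (hN : ∀ x : Fin d → ℝ, x ⬝ᵥ x = 1 → ∃ y ∈ N, (x - y) ⬝ᵥ (x - y) ≤ 1 / 4)
    (hN1 : ∀ y ∈ N, y ⬝ᵥ y = 1)
    (M : Matrix (Fin d) (Fin d) ℝ) {t : ℝ} (h : ∀ y ∈ N, |qf M y| ≤ t) (x : Fin d → ℝ) :
    |qf M x| ≤ 2 * t * (x ⬝ᵥ x) := by
  by_cases hx0 : x = 0
  · simp [hx0, qf]
  have hpos : ∀ v : Fin d → ℝ, v ≠ 0 → 0 < v ⬝ᵥ v := fun v hv =>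
    lt_of_le_of_ne (dotProduct_self_nonneg_real v) (fun h => hv (dotProduct_self_eq_zero.1 h.symm))
  have hunit : ∀ v : Fin d → ℝ, v ≠ 0 →
      ((√(v ⬝ᵥ v))⁻¹ • v) ⬝ᵥ ((√(v ⬝ᵥ v))⁻¹ • v) = 1 := fun v hv => by
    have := hpos v hv
    rw [smul_dotProduct, dotProduct_smul, smul_eq_mul, smul_eq_mul, ← mul_assoc, ← mul_inv,
      Real.mul_self_sqrt this.le, inv_mul_cancel₀ this.ne']
  let Sph : Set (Fin d → ℝ) := {v | v ⬝ᵥ v = 1}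
  have hcomp : IsCompact Sph := by
    refine Metric.isCompact_of_isClosed_isBounded (isClosed_eq (by fun_prop) continuous_const) ?_
    refine (Metric.isBounded_closedBall (x := (0 : Fin d → ℝ)) (r := 1)).subset fun v hv => ?_
    rw [mem_closedBall_zero_iff, pi_norm_le_iff_of_nonneg zero_le_one]
    intro i
    have h1 : v i * v i ≤ v ⬝ᵥ v :=
      Finset.single_le_sum (f := fun j => v j * v j) (fun j _ => mul_self_nonneg _)
        (Finset.mem_univ i)
    rw [show v ⬝ᵥ v = 1 from hv] at h1
    rw [Real.norm_eq_abs]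
    exact abs_le_one_iff_mul_self_le_one.2 h1
  obtain ⟨z, hz, hmax⟩ := hcomp.exists_isMaxOn ⟨_, hunit x hx0⟩
    (continuous_abs.comp (continuous_qf M)).continuousOn
  set κ := |qf M z| with hκ
  have hall : ∀ v : Fin d → ℝ, |qf M v| ≤ κ * (v ⬝ᵥ v) := fun v => by
    by_cases hv : v = 0
    · simp [hv, qf]
    have h1 : |qf M ((√(v ⬝ᵥ v))⁻¹ • v)| ≤ κ := hmax (hunit v hv)
    have h2 := hpos v hv
    rw [qf_smul, inv_pow, Real.sq_sqrt h2.le, abs_mul, abs_of_pos (inv_pos.2 h2),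
      inv_mul_le_iff₀ h2] at h1
    linarith
  obtain ⟨y, hy, hzy⟩ := hN z hz
  have hz1 : z ⬝ᵥ z = 1 := hz
  have hκ0 : 0 ≤ κ := abs_nonneg _
  -- The form κ|v|² − ε·qf M v is nonnegative and vanishes at the maximizer z, so its values at y
  -- and z − y agree. Hence κ − ε·qf M y ≤ 2κ|z − y|² ≤ κ/2, which is why a net as coarse as 1/2
  -- loses only a factor 2.
  have h4 : κ ≤ 2 * t := by
    obtain ⟨ε, hε, hεz⟩ : ∃ ε : ℝ, |ε| = 1 ∧ ε * qf M z = κ := by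
      rcases abs_cases (qf M z) with ⟨he, _⟩ | ⟨he, _⟩
      · exact ⟨1, by simp, by rw [hκ, he, one_mul]⟩
      · exact ⟨-1, by simp, by rw [hκ, he, neg_one_mul]⟩
    have habs : ∀ v, |ε * qf M v| = |qf M v| := fun v => by rw [abs_mul, hε, one_mul]
    have hp : ∀ v, qf (κ • 1 - ε • M) v = κ * (v ⬝ᵥ v) - ε * qf M v := fun v => by
      rw [qf_sub, qf_smul_left, qf_smul_left, qf_one]
    have hnn : ∀ v, 0 ≤ qf (κ • 1 - ε • M) v := fun v => by
      have := (le_abs_self _).trans ((habs v).le.trans (hall v))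
      rw [hp]; linarith
    have hpy := qf_sub_eq_of_isotropic hnn (z := z) (by rw [hp, hz1, hεz]; ring) (z - y)
    rw [sub_sub_cancel, hp, hp, hN1 y hy] at hpy
    have h1 := abs_le.1 ((habs (z - y)).le.trans (hall (z - y)))
    have h2 := (le_abs_self _).trans ((habs y).le.trans (h y hy))
    nlinarith
  exact (hall x).trans (mul_le_mul_of_nonneg_right h4 (dotProduct_self_nonneg_real x))

end QuadraticForm

/-! ### Exponential moments and Chernoff bounds -/

section Chernoff

variable {Ω : Type*} [MeasurableSpace Ω] {P : Measure Ω}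

/-- Chernoff's bound for a sum of independent variables. -/
lemma measure_sum_ge_le_of_mgf_le {ι : Type*} [Fintype ι] {X : ι → Ω → ℝ}
    (hindep : iIndepFun X P) (hX : ∀ i, AEMeasurable (X i) P) {s : ℝ} (hs : 0 ≤ s) {b : ι → ℝ}
    (hint : ∀ i, Integrable (fun ω => Real.exp (s * X i ω)) P)
    (hmgf : ∀ i, mgf (X i) P s ≤ Real.exp (b i)) (ε : ℝ) :
    P {ω | ε ≤ ∑ i, X i ω} ≤ ENNReal.ofReal (Real.exp (-s * ε + ∑ i, b i)) := by
  have := hindep.isProbabilityMeasure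
  have hsum := hindep.mgf_sum₀ (t := s) hX Finset.univ
  have hpos : 0 < mgf (∑ i, X i) P s := by
    rw [hsum]; exact Finset.prod_pos fun i _ => mgf_pos (hint i)
  -- A nonintegrable function has integral 0, so positivity of the mgf already proves integrability.
  have hI : Integrable (fun ω => Real.exp (s * (∑ i, X i) ω)) P := by
    by_contra h
    rw [mgf, integral_undef h] at hpos
    exact lt_irrefl _ hpos
  have key := measure_ge_le_exp_mul_mgf (X := ∑ i, X i) (μ := P) ε hs hI
  rw [← ofReal_measureReal]
  refine ENNReal.ofReal_le_ofReal ?_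
  simp only [Finset.sum_apply] at key
  refine key.trans ?_
  rw [Real.exp_add, Real.exp_sum, hsum]
  gcongr with i
  · exact fun i _ => mgf_nonneg
  · exact hmgf i

lemma exp_sub_one_sub_id_le (y : ℝ) : Real.exp y ≤ 1 + y + y ^ 2 * Real.exp |y| := by
  have h := Complex.norm_exp_sub_sum_le_norm_mul_exp (y : ℂ) 2
  simp only [Finset.sum_range_succ, Finset.sum_range_zero, pow_zero, pow_one, Nat.factorial,
    Nat.cast_one, div_one, zero_add, mul_one, Complex.norm_real, Real.norm_eq_abs, sq_abs] at h
  rw [← Complex.ofReal_exp, ← Complex.ofReal_one, ← Complex.ofReal_add, ← Complex.ofReal_sub,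
    Complex.norm_real, Real.norm_eq_abs] at h
  linarith [le_abs_self (Real.exp y - (1 + y))]

lemma integrable_exp_of_lintegral_le {V : Ω → ℝ} (hV : AEMeasurable V P)
    (hexp : ∫⁻ ω, ENNReal.ofReal (Real.exp (V ω)) ∂P ≤ 2) :
    Integrable (fun ω => Real.exp (V ω)) P ∧ ∫ ω, Real.exp (V ω) ∂P ≤ 2 := by
  have hm : AEStronglyMeasurable (fun ω => Real.exp (V ω)) P := hV.exp.aestronglyMeasurable
  have hnn : 0 ≤ᵐ[P] fun ω => Real.exp (V ω) := ae_of_all _ fun ω => (Real.exp_pos _).le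
  constructor
  · refine ⟨hm, ?_⟩
    rw [hasFiniteIntegral_iff_ofReal hnn]
    exact hexp.trans_lt (by simp)
  · rw [integral_eq_lintegral_of_nonneg_ae hnn hm]
    exact ENNReal.toReal_le_of_le_ofReal (by norm_num) (by simpa using hexp)

/-- Bernstein's bound on the moment generating function of a centered nonnegative
subexponential variable. -/
lemma mgf_sub_integral_le [IsProbabilityMeasure P] {V : Ω → ℝ} (hV : AEMeasurable V P)
    (h0 : ∀ ω, 0 ≤ V ω) (hexp : ∫⁻ ω, ENNReal.ofReal (Real.exp (V ω)) ∂P ≤ 2)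
    {s : ℝ} (hs : |s| ≤ 1 / 4) :
    Integrable (fun ω => Real.exp (s * (V ω - ∫ ω', V ω' ∂P))) P ∧
      mgf (fun ω => V ω - ∫ ω', V ω' ∂P) P s ≤ Real.exp (192 * s ^ 2) := by
  obtain ⟨hI, hI2⟩ := integrable_exp_of_lintegral_le hV hexp
  have hVexp : ∀ ω, V ω + 1 ≤ Real.exp (V ω) := fun ω => Real.add_one_le_exp _
  have hVint : Integrable V P := hI.mono' hV.aestronglyMeasurable <| ae_of_all _ fun ω => by
    rw [Real.norm_eq_abs, abs_of_nonneg (h0 ω)]; linarith [hVexp ω]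
  set a := ∫ ω', V ω' ∂P with ha
  have ha0 : 0 ≤ a := integral_nonneg h0
  have ha1 : a ≤ 1 := by
    have : ∫ ω, (V ω + 1) ∂P ≤ ∫ ω, Real.exp (V ω) ∂P :=
      integral_mono (hVint.add (integrable_const _)) hI hVexp
    rw [integral_add hVint (integrable_const _)] at this
    simp at this
    linarith
  -- Here 96 = 32·3: the square costs 32·exp(|Y|/4), and |Y| ≤ V + 1 costs e ≤ 3. Taking
  -- expectations kills the linear term and leaves 1 + 192s².
  have hpt : ∀ ω, Real.exp (s * (V ω - a)) ≤
      1 + s * (V ω - a) + 96 * s ^ 2 * Real.exp (V ω) := fun ω => by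
    set Y := V ω - a with hY
    have hYabs : |Y| ≤ V ω + 1 := abs_le.2 ⟨by linarith [h0 ω], by linarith [h0 ω]⟩
    have h1 := exp_sub_one_sub_id_le (s * Y)
    have h2 : |s * Y| ≤ |Y| / 4 := by
      rw [abs_mul]; nlinarith [abs_nonneg Y]
    have h3 : Y ^ 2 ≤ 32 * Real.exp (|Y| / 4) := by
      have := Real.quadratic_le_exp_of_nonneg (x := |Y| / 4) (by positivity)
      nlinarith [sq_abs Y, abs_nonneg Y]
    have h4 : Y ^ 2 * Real.exp |s * Y| ≤ 96 * Real.exp (V ω) := by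
      calc Y ^ 2 * Real.exp |s * Y| ≤ 32 * Real.exp (|Y| / 4) * Real.exp (|Y| / 4) := by
            gcongr
        _ = 32 * Real.exp (|Y| / 2) := by rw [mul_assoc, ← Real.exp_add]; ring_nf
        _ ≤ 32 * Real.exp (V ω + 1) := by
            gcongr; linarith [abs_nonneg Y]
        _ ≤ 96 * Real.exp (V ω) := by
            rw [Real.exp_add]
            nlinarith [Real.exp_one_lt_d9, Real.exp_pos (V ω)]
    have h5 : (s * Y) ^ 2 * Real.exp |s * Y| = s ^ 2 * (Y ^ 2 * Real.exp |s * Y|) := by ring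
    rw [h5] at h1
    nlinarith [sq_nonneg s]
  have hlin : Integrable (fun ω => s * (V ω - a)) P := (hVint.sub (integrable_const _)).const_mul s
  have hlin1 : Integrable (fun ω => 1 + s * (V ω - a)) P := (integrable_const _).add hlin
  have hbd := hlin1.add (hI.const_mul (96 * s ^ 2))
  have hint : Integrable (fun ω => Real.exp (s * (V ω - a))) P :=
    hbd.mono' ((hV.sub_const a).const_mul s).exp.aestronglyMeasurable <| ae_of_all _ fun ω => by
      rw [Real.norm_eq_abs, Real.abs_exp]; exact hpt ω
  refine ⟨hint, (integral_mono hint hbd hpt).trans ?_⟩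
  have hz : ∫ ω, s * (V ω - a) ∂P = 0 := by
    rw [integral_const_mul, integral_sub hVint (integrable_const _), ← ha]; simp
  simp only [Pi.add_apply]
  rw [integral_add hlin1 (hI.const_mul _), integral_add (integrable_const _) hlin, hz,
    integral_const_mul]
  have := Real.add_one_le_exp (192 * s ^ 2)
  simp
  nlinarith [sq_nonneg s]

end Chernoff

/-! ### Square roots and congruences -/

section SquareRoot

variable {d : ℕ} {A : Matrix (Fin d) (Fin d) ℝ}

lemma sqrtM_mul_self (hA : A.PosSemidef) : sqrtM A * sqrtM A = A :=
  CFC.sqrt_mul_sqrt_self A hA.nonneg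

lemma sqrtM_transpose (A : Matrix (Fin d) (Fin d) ℝ) : (sqrtM A)ᵀ = sqrtM A := by
  have := (CFC.sqrt_nonneg A).posSemidef.isHermitian
  rwa [IsHermitian, conjTranspose_eq_transpose_of_trivial] at this

lemma invSqrtM_transpose (A : Matrix (Fin d) (Fin d) ℝ) : (invSqrtM A)ᵀ = invSqrtM A := by
  rw [invSqrtM, transpose_nonsing_inv, sqrtM_transpose]

lemma isUnit_det_sqrtM (hA : A.PosDef) : IsUnit (sqrtM A).det := by
  have h := hA.det_pos
  rw [← sqrtM_mul_self hA.posSemidef, det_mul] at h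
  exact isUnit_iff_ne_zero.2 fun h0 => by simp [h0] at h

lemma sqrtM_mul_invSqrtM (hA : A.PosDef) : sqrtM A * invSqrtM A = 1 :=
  mul_nonsing_inv _ (isUnit_det_sqrtM hA)

lemma invSqrtM_mul_sqrtM (hA : A.PosDef) : invSqrtM A * sqrtM A = 1 :=
  nonsing_inv_mul _ (isUnit_det_sqrtM hA)

lemma invSqrtM_mul_self (hA : A.PosDef) : invSqrtM A * invSqrtM A = A⁻¹ := by
  rw [invSqrtM, ← Matrix.mul_inv_rev, sqrtM_mul_self hA.posSemidef]

lemma qf_conj {T : Matrix (Fin d) (Fin d) ℝ} (hT : Tᵀ = T) (M : Matrix (Fin d) (Fin d) ℝ)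
    (x : Fin d → ℝ) : qf (T * M * T) x = qf M (T *ᵥ x) := by
  simp only [qf, ← mulVec_mulVec, dotProduct_mulVec x T, ← mulVec_transpose, hT]

lemma qf_eq_sqrtM (hA : A.PosSemidef) (x : Fin d → ℝ) :
    qf A x = (sqrtM A *ᵥ x) ⬝ᵥ (sqrtM A *ᵥ x) := by
  rw [← qf_one, ← qf_conj (sqrtM_transpose A), mul_one, sqrtM_mul_self hA]

lemma qf_invSqrtM (hA : A.PosDef) (x : Fin d → ℝ) : qf A (invSqrtM A *ᵥ x) = x ⬝ᵥ x := by
  rw [qf_eq_sqrtM hA.posSemidef, mulVec_mulVec, sqrtM_mul_invSqrtM hA, one_mulVec]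

lemma qf_inv (hA : A.PosDef) (x : Fin d → ℝ) :
    qf A⁻¹ x = (invSqrtM A *ᵥ x) ⬝ᵥ (invSqrtM A *ᵥ x) := by
  rw [← qf_one, ← qf_conj (invSqrtM_transpose A), mul_one, invSqrtM_mul_self hA]

lemma qf_secondMoment {n : ℕ} (x : Fin n → EuclideanSpace ℝ (Fin d)) (u : Fin d → ℝ) :
    qf (secondMoment x) u = (1 / (n : ℝ)) * ∑ i, ((x i).ofLp ⬝ᵥ u) ^ 2 := by
  rw [secondMoment, qf_smul_left, qf, sum_mulVec, dotProduct_sum]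
  congr 1
  refine Finset.sum_congr rfl fun i _ => ?_
  rw [vecMulVec_mulVec, dotProduct_smul, pow_two, dotProduct_comm u]
  simp

lemma isHermitian_secondMoment {n : ℕ} (x : Fin n → EuclideanSpace ℝ (Fin d)) :
    (secondMoment x).IsHermitian := by
  rw [IsHermitian, conjTranspose_eq_transpose_of_trivial, secondMoment, transpose_smul,
    transpose_sum]
  simp [transpose_vecMulVec]

end SquareRoot

/-! ### Concentration of second-moment matrices -/

section Concentration

variable {Ω : Type*} [MeasurableSpace Ω] {P : Measure Ω} {d n : ℕ}

/-- Bernstein's inequality for averages of independent nonnegative subexponential variables. -/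
lemma measure_le_abs_average_sub_le [IsProbabilityMeasure P] {V : Fin n → Ω → ℝ} {a δ : ℝ}
    (hn : 1 ≤ n) (hindep : iIndepFun V P) (hV : ∀ i, AEMeasurable (V i) P)
    (h0 : ∀ i ω, 0 ≤ V i ω) (hexp : ∀ i, ∫⁻ ω, ENNReal.ofReal (Real.exp (V i ω)) ∂P ≤ 2)
    (ha : ∀ i, ∫ ω, V i ω ∂P = a) (hδ : 0 ≤ δ) :
    P {ω | 56 * max δ (δ ^ 2) ≤ |(1 / (n : ℝ)) * ∑ i, V i ω - a|} ≤
      ENNReal.ofReal (2 * Real.exp (-2 * (n * δ ^ 2))) := by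
  have hn0 : (0 : ℝ) < n := by exact_mod_cast hn
  set m := max δ (δ ^ 2)
  -- Taking s = min(δ, 1)/4 covers both Bernstein regimes; the exponent is then at most (−14 +
  -- 12)nδ².
  obtain ⟨s, hs0, hs1, hsm, hs2⟩ : ∃ s : ℝ, 0 ≤ s ∧ s ≤ 1 / 4 ∧ s * m = δ ^ 2 / 4 ∧
      s ^ 2 ≤ δ ^ 2 / 16 := by
    rcases le_total δ 1 with h | h
    · refine ⟨δ / 4, by positivity, by linarith, ?_, by ring_nf; rfl⟩
      rw [show m = δ from max_eq_left (by nlinarith)]; ring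
    · refine ⟨1 / 4, by positivity, le_rfl, ?_, by nlinarith⟩
      rw [show m = δ ^ 2 from max_eq_right (by nlinarith)]; ring
  have side : ∀ ε : ℝ, |ε| = 1 →
      P {ω | n * (56 * m) ≤ ∑ i, ε * (V i ω - a)} ≤
        ENNReal.ofReal (Real.exp (-2 * (n * δ ^ 2))) := fun ε hε => by
    have hb : ∀ i, Integrable (fun ω => Real.exp (s * (ε * (V i ω - a)))) P ∧
        mgf (fun ω => ε * (V i ω - a)) P s ≤ Real.exp (192 * s ^ 2) := fun i => by
      have := mgf_sub_integral_le (s := s * ε) (hV i) (h0 i) (hexp i)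
        (by rw [abs_mul, hε, abs_of_nonneg hs0]; linarith)
      rw [ha i, mul_pow, ← sq_abs ε, hε] at this
      simp only [mgf, mul_assoc, one_pow, mul_one] at this ⊢
      exact this
    refine (measure_sum_ge_le_of_mgf_le (X := fun i ω => ε * (V i ω - a))
      (hindep.comp (fun _ v => ε * (v - a)) fun _ => by fun_prop)
      (fun i => ((hV i).sub_const a).const_mul ε) hs0 (fun i => (hb i).1)
      (fun i => (hb i).2) _).trans ?_
    refine ENNReal.ofReal_le_ofReal (Real.exp_le_exp.2 ?_)
    rw [Finset.sum_const, Finset.card_univ, Fintype.card_fin, nsmul_eq_mul]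
    have h1 : -s * (n * (56 * m)) = -14 * (n * δ ^ 2) := by linear_combination (-56 * n : ℝ) * hsm
    have h2 : (n : ℝ) * (192 * s ^ 2) ≤ 12 * (n * δ ^ 2) := by nlinarith
    linarith
  have hsub : {ω | 56 * m ≤ |(1 / (n : ℝ)) * ∑ i, V i ω - a|} ⊆
      {ω | n * (56 * m) ≤ ∑ i, (1 : ℝ) * (V i ω - a)} ∪
      {ω | n * (56 * m) ≤ ∑ i, (-1 : ℝ) * (V i ω - a)} := fun ω hω => by
    simp only [Set.mem_ofPred_eq, Set.mem_union, ← Finset.mul_sum, Finset.sum_sub_distrib,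
      Finset.sum_const, Finset.card_univ, Fintype.card_fin, nsmul_eq_mul] at hω ⊢
    have h1 : (n : ℝ) * ((1 / (n : ℝ)) * ∑ i, V i ω - a) = ∑ i, V i ω - n * a := by
      field_simp
    rcases le_abs.1 hω with h | h
    · left; nlinarith [mul_le_mul_of_nonneg_left h hn0.le]
    · right; nlinarith [mul_le_mul_of_nonneg_left h hn0.le]
  refine (measure_mono hsub).trans ((measure_union_le _ _).trans ?_)
  rw [two_mul, ENNReal.ofReal_add (Real.exp_pos _).le (Real.exp_pos _).le]
  exact add_le_add (side 1 (by simp)) (side (-1) (by simp))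

/-- Union bound over a net: pointwise tail bounds for a random quadratic form give a uniform one. -/
lemma measure_not_forall_abs_qf_le {M : Ω → Matrix (Fin d) (Fin d) ℝ} {t η : ℝ} (hη : 0 ≤ η)
    (h : ∀ y : Fin d → ℝ, y ⬝ᵥ y = 1 →
      P {ω | t ≤ |qf (M ω) y|} ≤ ENNReal.ofReal (2 * (Real.exp (-2 * d) * η))) :
    P {ω | ¬ ∀ x, |qf (M ω) x| ≤ 2 * t * (x ⬝ᵥ x)} ≤ ENNReal.ofReal (2 * η) := by
  obtain ⟨N, hcard, hN1, hN⟩ := exists_sphere_net d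
  have hsub : {ω | ¬ ∀ x, |qf (M ω) x| ≤ 2 * t * (x ⬝ᵥ x)} ⊆
      ⋃ y ∈ N, {ω | t ≤ |qf (M ω) y|} := fun ω hω => by
    by_contra hcon
    simp only [Set.mem_iUnion, Set.mem_ofPred_eq, not_exists, not_le] at hcon
    exact hω fun x => abs_qf_le_of_net hN hN1 _ (fun y hy => (hcon y hy).le) x
  refine (measure_mono hsub).trans ((measure_biUnion_finset_le _ _).trans ?_)
  refine (Finset.sum_le_sum fun y hy => h y (hN1 y hy)).trans ?_
  rw [Finset.sum_const, nsmul_eq_mul, ← ENNReal.ofReal_natCast,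
    ← ENNReal.ofReal_mul (by positivity)]
  refine ENNReal.ofReal_le_ofReal ?_
  -- Since 5 ≤ e², the factor exp(−2d) in the pointwise tail absorbs the size of the net.
  have h5 : (N.card : ℝ) ≤ Real.exp (2 * d) := by
    calc (N.card : ℝ) ≤ (5 : ℝ) ^ d := by exact_mod_cast hcard
      _ ≤ (Real.exp 2) ^ d := by
        gcongr
        rw [show (2 : ℝ) = 1 + 1 by norm_num, Real.exp_add]
        nlinarith [Real.exp_one_gt_d9]
      _ = Real.exp (2 * d) := by rw [← Real.exp_nat_mul, mul_comm]
  calc (N.card : ℝ) * (2 * (Real.exp (-2 * d) * η))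
      ≤ Real.exp (2 * d) * (2 * (Real.exp (-2 * d) * η)) := by gcongr
    _ = 2 * η * (Real.exp (2 * d) * Real.exp (-2 * d)) := by ring
    _ = 2 * η := by rw [← Real.exp_add]; simp

lemma exp_neg_devTerm_le {η x : ℝ} (hη : 0 < η) (hη1 : η < 1)
    (hx : d + Real.log (1 / η) ≤ x) : Real.exp (-2 * x) ≤ Real.exp (-2 * d) * η := by
  have hlog : 0 < Real.log (1 / η) := Real.log_pos (by rwa [lt_div_iff₀ hη, one_mul])
  calc Real.exp (-2 * x) ≤ Real.exp (-2 * d + -Real.log (1 / η)) := by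
        gcongr; linarith
    _ = Real.exp (-2 * d) * η := by
        rw [Real.exp_add, one_div, Real.log_inv, neg_neg, Real.exp_log hη]

lemma le_devTerm_sq {η : ℝ} (hη : 0 < η) (hη1 : η < 1) :
    d + Real.log (1 / η) ≤ devTerm d η ^ 2 := by
  have hlog : 0 < Real.log (1 / η) := Real.log_pos (by rwa [lt_div_iff₀ hη, one_mul])
  have h1 := Real.sq_sqrt (Nat.cast_nonneg (α := ℝ) d)
  have h2 := Real.sq_sqrt hlog.le
  rw [devTerm]
  nlinarith [Real.sqrt_nonneg (d : ℝ), Real.sqrt_nonneg (Real.log (1 / η)),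
    mul_nonneg (Real.sqrt_nonneg (d : ℝ)) (Real.sqrt_nonneg (Real.log (1 / η)))]

lemma IsSubG.aemeasurable {K : ℝ} {S : Matrix (Fin d) (Fin d) ℝ} {X : Ω → EuclideanSpace ℝ (Fin d)}
    (h : IsSubG P K S X) : AEMeasurable X P := h.memLp.aestronglyMeasurable.aemeasurable

lemma IsSubG.integral_dotProduct_sq {K : ℝ} {S : Matrix (Fin d) (Fin d) ℝ}
    {X : Ω → EuclideanSpace ℝ (Fin d)} (h : IsSubG P K S X) (u : Fin d → ℝ) :
    ∫ ω, ((X ω).ofLp ⬝ᵥ u) ^ 2 ∂P = qf S u := by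
  have hL : ∀ i, MemLp (fun ω => X ω i) 2 P := fun i =>
    (EuclideanSpace.proj (𝕜 := ℝ) i).comp_memLp' h.memLp
  have hint : ∀ i j, Integrable (fun ω => X ω i * X ω j) P := fun i j =>
    (hL i).integrable_mul (hL j)
  have hexp : ∀ ω, ((X ω).ofLp ⬝ᵥ u) ^ 2 = ∑ i, ∑ j, u i * u j * (X ω i * X ω j) := fun ω => by
    rw [pow_two, dotProduct, Finset.sum_mul_sum]
    exact Finset.sum_congr rfl fun i _ => Finset.sum_congr rfl fun j _ => by ring
  simp_rw [hexp]
  rw [integral_finsetSum _ fun i _ => integrable_finsetSum _ fun j _ => (hint i j).const_mul _]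
  simp only [qf, dotProduct, mulVec, Finset.mul_sum]
  refine Finset.sum_congr rfl fun i _ => ?_
  rw [integral_finsetSum _ fun j _ => (hint i j).const_mul _]
  refine Finset.sum_congr rfl fun j _ => ?_
  rw [integral_const_mul, h.second_moment]; ring

lemma IsSubG.lintegral_exp_le {K : ℝ} {S : Matrix (Fin d) (Fin d) ℝ}
    {X : Ω → EuclideanSpace ℝ (Fin d)} (h : IsSubG P K S X) {u : Fin d → ℝ} (hu : qf S u = 1) :
    ∫⁻ ω, ENNReal.ofReal (Real.exp (((X ω).ofLp ⬝ᵥ u) ^ 2 / K ^ 2)) ∂P ≤ 2 := by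
  have := h.psi2_le (WithLp.toLp 2 u)
  simp only [EuclideanSpace.inner_eq_star_dotProduct, star_trivial] at this
  rwa [show u ⬝ᵥ S *ᵥ u = 1 from hu, mul_one] at this

/-- Concentration of the sample second-moment matrix, relative to the population one. -/
lemma measure_not_secondMoment_close [IsProbabilityMeasure P] {K η : ℝ} (hK : 0 < K)
    {S : Matrix (Fin d) (Fin d) ℝ} (hS : S.PosDef)
    {X : Fin n → Ω → EuclideanSpace ℝ (Fin d)} (hX : IsIIDSubG P K S X) (hn : 1 ≤ n)
    (hη : 0 < η) (hη1 : η < 1) {δ : ℝ} (hδ : δ = devTerm d η / √(n : ℝ)) :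
    P {ω | ¬ ∀ u, |qf (secondMoment (X · ω)) u - qf S u| ≤
      112 * K ^ 2 * max δ (δ ^ 2) * qf S u} ≤ ENNReal.ofReal (2 * η) := by
  have hn0 : (0 : ℝ) < n := by exact_mod_cast hn
  have hδ0 : 0 ≤ δ := by rw [hδ, devTerm]; positivity
  have hnδ : n * δ ^ 2 = devTerm d η ^ 2 := by
    rw [hδ, div_pow, Real.sq_sqrt hn0.le]; field_simp
  -- Whitening by S turns the relative error into an absolute one on the Euclidean sphere. Passing
  -- from the net to the sphere doubles 56K² to 112K².
  let M : Ω → Matrix (Fin d) (Fin d) ℝ := fun ω =>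
    invSqrtM S * (secondMoment (X · ω) - S) * invSqrtM S
  have key := measure_not_forall_abs_qf_le (P := P) (M := M)
    (t := 56 * K ^ 2 * max δ (δ ^ 2)) hη.le fun y hy => by
      set u := invSqrtM S *ᵥ y with hu
      have hSu : qf S u = 1 := by rw [hu, qf_invSqrtM hS, hy]
      have hmeas : Measurable fun x : EuclideanSpace ℝ (Fin d) => (x.ofLp ⬝ᵥ u) ^ 2 / K ^ 2 := by
        have : Continuous fun x : EuclideanSpace ℝ (Fin d) => (x.ofLp ⬝ᵥ u) ^ 2 / K ^ 2 := by
          fun_prop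
        exact this.measurable
      have h1 := measure_le_abs_average_sub_le (P := P) (δ := δ) (a := 1 / K ^ 2)
        (V := fun i ω => ((X i ω).ofLp ⬝ᵥ u) ^ 2 / K ^ 2) hn
        (hX.indep.comp _ fun _ => hmeas)
        (fun i => hmeas.comp_aemeasurable (hX.subG i).aemeasurable)
        (fun i ω => by positivity) (fun i => (hX.subG i).lintegral_exp_le hSu)
        (fun i => by rw [integral_div, (hX.subG i).integral_dotProduct_sq, hSu]) hδ0
      refine le_trans (measure_mono fun ω hω => ?_) (h1.trans ?_)
      · simp only [Set.mem_ofPred_eq, M, qf_conj (invSqrtM_transpose S)] at hω ⊢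
        rw [← hu, qf_sub, hSu, qf_secondMoment] at hω
        rw [← Finset.sum_div, ← mul_div_assoc, ← sub_div, abs_div,
          abs_of_pos (a := K ^ 2) (by positivity), le_div_iff₀ (by positivity)]
        linarith
      · refine ENNReal.ofReal_le_ofReal (mul_le_mul_of_nonneg_left ?_ two_pos.le)
        exact exp_neg_devTerm_le hη hη1 (by rw [hnδ]; exact le_devTerm_sq hη hη1)
  refine (measure_mono fun ω hω => ?_).trans key
  simp only [Set.mem_ofPred_eq] at hω ⊢
  refine fun h => hω fun u => ?_
  have := h (sqrtM S *ᵥ u)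
  rw [← qf_eq_sqrtM hS.posSemidef] at this
  simp only [M, qf_conj (invSqrtM_transpose S)] at this
  rw [mulVec_mulVec, invSqrtM_mul_sqrtM hS, one_mulVec, qf_sub] at this
  linarith

end Concentration

/-! ### Tails of private norms and of the Gaussian noise -/

section Tails

variable {Ω : Type*} [MeasurableSpace Ω] {P : Measure Ω} {d n : ℕ}

/-- The whitened squared norm of a sub-Gaussian vector has an exponential tail at scale `d K²`. -/
lemma IsSubG.measure_le_qf_inv [IsProbabilityMeasure P] {K : ℝ} (hK : 0 < K)
    {S : Matrix (Fin d) (Fin d) ℝ} (hS : S.PosDef) {X : Ω → EuclideanSpace ℝ (Fin d)}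
    (hX : IsSubG P K S X) (hd : 1 ≤ d) (t : ℝ) :
    P {ω | d * K ^ 2 * t ≤ qf S⁻¹ (X ω).ofLp} ≤ ENNReal.ofReal (2 * Real.exp (-t)) := by
  have hd0 : (0 : ℝ) < d := by exact_mod_cast hd
  let V : Fin d → Ω → ℝ := fun j ω => ((X ω).ofLp ⬝ᵥ (invSqrtM S *ᵥ Pi.single j 1)) ^ 2 / K ^ 2
  have hV : ∀ j, AEMeasurable (V j) P := fun j => by
    have : Continuous fun x : EuclideanSpace ℝ (Fin d) =>
        (x.ofLp ⬝ᵥ (invSqrtM S *ᵥ Pi.single j 1)) ^ 2 / K ^ 2 := by fun_prop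
    exact this.measurable.comp_aemeasurable hX.aemeasurable
  have hVe := fun j => integrable_exp_of_lintegral_le (hV j)
    (hX.lintegral_exp_le (u := invSqrtM S *ᵥ Pi.single j 1) (by rw [qf_invSqrtM hS]; simp))
  let W : Ω → ℝ := fun ω => ∑ j, (1 / (d : ℝ)) * V j ω
  have hWm : AEMeasurable W P := Finset.aemeasurable_fun_sum _ fun j _ => (hV j).const_mul _
  have hW : ∀ ω, qf S⁻¹ (X ω).ofLp = d * K ^ 2 * W ω := fun ω => by
    have hj : ∀ j, (X ω).ofLp ⬝ᵥ (invSqrtM S *ᵥ Pi.single j 1) =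
        (invSqrtM S *ᵥ (X ω).ofLp) j := fun j => by
      rw [dotProduct_mulVec, ← mulVec_transpose, invSqrtM_transpose]; simp
    simp only [qf_inv hS, W, V, hj, ← Finset.mul_sum, ← Finset.sum_div]
    rw [dotProduct]
    field_simp
  -- Jensen's inequality reduces the averaged norm to one-dimensional marginals, so the whitened
  -- coordinates may be dependent.
  have hpt : ∀ ω, Real.exp (W ω) ≤ ∑ j, (1 / (d : ℝ)) * Real.exp (V j ω) := fun ω => by
    have := convexOn_exp.map_sum_le (t := Finset.univ) (w := fun _ : Fin d => 1 / (d : ℝ))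
      (p := fun j => V j ω) (fun _ _ => by positivity) (by simp [hd0.ne']) (fun _ _ => Set.mem_univ _)
    simpa only [smul_eq_mul] using this
  have hsum : Integrable (fun ω => ∑ j, (1 / (d : ℝ)) * Real.exp (V j ω)) P :=
    integrable_finsetSum _ fun j _ => (hVe j).1.const_mul _
  have hI : Integrable (fun ω => Real.exp (W ω)) P :=
    hsum.mono' hWm.exp.aestronglyMeasurable <| ae_of_all _ fun ω => by
      rw [Real.norm_eq_abs, Real.abs_exp]; exact hpt ω
  have hE : ∫ ω, Real.exp (W ω) ∂P ≤ 2 := by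
    refine (integral_mono hI hsum hpt).trans ?_
    rw [integral_finsetSum _ fun j _ => (hVe j).1.const_mul _]
    simp_rw [integral_const_mul]
    refine (Finset.sum_le_sum fun j _ => mul_le_mul_of_nonneg_left (hVe j).2
      (by positivity)).trans ?_
    simp [hd0.ne']
  have key := measure_ge_le_exp_mul_mgf (X := W) (μ := P) t zero_le_one (by simpa using hI)
  rw [mgf] at key
  simp only [one_mul] at key
  have hset : {ω | d * K ^ 2 * t ≤ qf S⁻¹ (X ω).ofLp} = {ω | t ≤ W ω} := by
    ext ω
    rw [Set.mem_ofPred_eq, Set.mem_ofPred_eq, hW, mul_le_mul_iff_right₀ (by positivity)]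
  rw [hset, ← ofReal_measureReal]
  refine ENNReal.ofReal_le_ofReal (key.trans ?_)
  rw [neg_one_mul]
  nlinarith [Real.exp_pos (-t)]

lemma measure_exists_le_qf_inv [IsProbabilityMeasure P] {K η : ℝ} (hK : 0 < K)
    {S : Matrix (Fin d) (Fin d) ℝ} (hS : S.PosDef)
    {X : Fin n → Ω → EuclideanSpace ℝ (Fin d)} (hX : ∀ i, IsSubG P K S (X i)) (hd : 1 ≤ d)
    (hn : 1 ≤ n) (hη : 0 < η) :
    P {ω | ∃ i, d * K ^ 2 * Real.log (2 * n / η) ≤ qf S⁻¹ (X i ω).ofLp} ≤ ENNReal.ofReal η := by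
  have hn0 : (0 : ℝ) < n := by exact_mod_cast hn
  rw [Set.ofPred_exists]
  refine (measure_iUnion_fintype_le _ _).trans ?_
  refine (Finset.sum_le_sum fun i _ => (hX i).measure_le_qf_inv hK hS hd _).trans ?_
  rw [Finset.sum_const, Finset.card_univ, Fintype.card_fin, nsmul_eq_mul, ← ENNReal.ofReal_natCast,
    ← ENNReal.ofReal_mul (by positivity), Real.exp_neg, Real.exp_log (by positivity)]
  refine ENNReal.ofReal_le_ofReal (le_of_eq ?_)
  field_simp

/-- Folding onto the upper triangle writes the Gaussian quadratic form as a sum over independent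
entries. -/
lemma sum_sum_eq_sum_le {f : Fin d → Fin d → ℝ} (hf : ∀ i j, f i j = f j i) :
    ∑ i, ∑ j, f i j =
      ∑ p : {p : Fin d × Fin d // p.1 ≤ p.2},
        (if p.1.1 = p.1.2 then 1 else 2) * f p.1.1 p.1.2 := by
  have h1 : ∑ p : {p : Fin d × Fin d // p.1 ≤ p.2},
        (if p.1.1 = p.1.2 then 1 else 2) * f p.1.1 p.1.2 =
      ∑ i, ∑ j, if i ≤ j then (if i = j then 1 else 2) * f i j else 0 := by
    rw [← Fintype.sum_prod_type', ← Finset.sum_filter]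
    exact (Finset.sum_subtype _ (by simp) fun p : Fin d × Fin d =>
      (if p.1 = p.2 then (1 : ℝ) else 2) * f p.1 p.2).symm
  have h2 : ∑ i, ∑ j, f i j =
      ∑ i, ∑ j, (if i ≤ j then f i j else 0) + ∑ i, ∑ j, (if j < i then f i j else 0) := by
    simp_rw [← Finset.sum_add_distrib]
    refine Finset.sum_congr rfl fun i _ => Finset.sum_congr rfl fun j _ => ?_
    rcases le_or_gt i j with h | h
    · simp [h, h.not_gt]
    · simp [h, h.not_ge]
  rw [h1, h2, Finset.sum_comm (f := fun i j => if j < i then f i j else 0)]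
  simp_rw [← Finset.sum_add_distrib]
  refine Finset.sum_congr rfl fun i _ => Finset.sum_congr rfl fun j _ => ?_
  rcases lt_trichotomy i j with h | h | h
  · simp [h, h.le, h.ne, hf j i]; ring
  · simp [h]
  · simp [h.not_ge, h.not_gt]

/-- Sub-Gaussian tail of a quadratic form of a symmetric Gaussian matrix. -/
lemma IsSymmGaussian.measure_le_abs_qf {σ ℓ : ℝ} (hσ : 0 < σ) (hℓ : 0 ≤ ℓ)
    {G : Ω → Matrix (Fin d) (Fin d) ℝ} (hG : IsSymmGaussian P σ G) {y : Fin d → ℝ}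
    (hy : y ⬝ᵥ y = 1) :
    P {ω | σ * √(8 * ℓ) ≤ |qf (G ω) y|} ≤ ENNReal.ofReal (2 * Real.exp (-2 * ℓ)) := by
  let m : {p : Fin d × Fin d // p.1 ≤ p.2} → ℝ := fun p => if p.1.1 = p.1.2 then 1 else 2
  let c : {p : Fin d × Fin d // p.1 ≤ p.2} → ℝ := fun p => m p * (y p.1.1 * y p.1.2)
  have hm : ∀ p, 0 ≤ m p ∧ m p ≤ 2 := fun p => by
    simp only [m]; split_ifs <;> norm_num
  -- The weights m are at most 2, and the once-weighted sum of yᵢ²yⱼ² is |y|⁴ = 1.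
  have hc : ∑ p, c p ^ 2 ≤ 2 := by
    have h1 : ∑ i, ∑ j, y i ^ 2 * y j ^ 2 = 1 := by
      rw [← Finset.sum_mul_sum]
      simp_rw [pow_two]
      rw [show ∑ i, y i * y i = 1 from hy, one_mul]
    rw [sum_sum_eq_sum_le fun i j => mul_comm _ _] at h1
    calc ∑ p, c p ^ 2 ≤ ∑ p, 2 * (m p * (y p.1.1 ^ 2 * y p.1.2 ^ 2)) := by
          refine Finset.sum_le_sum fun p _ => ?_
          have h2 : c p ^ 2 = m p * (m p * (y p.1.1 ^ 2 * y p.1.2 ^ 2)) := by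
            simp only [c]; ring
          rw [h2]
          exact mul_le_mul_of_nonneg_right (hm p).2 (mul_nonneg (hm p).1 (by positivity))
      _ = 2 := by rw [← Finset.mul_sum, h1, mul_one]
  have hqf : ∀ᵐ ω ∂P, qf (G ω) y = ∑ p, c p * G ω p.1.1 p.1.2 := by
    filter_upwards [hG.symm] with ω hω
    have := sum_sum_eq_sum_le (f := fun i j => y i * y j * G ω i j)
      fun i j => by rw [hω.apply j i]; ring
    simp only [qf, dotProduct, mulVec, Finset.mul_sum]
    convert this using 1
    · exact Finset.sum_congr rfl fun i _ => Finset.sum_congr rfl fun j _ => by ring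
    · exact Finset.sum_congr rfl fun p _ => by simp only [c, m]; ring
  have hu := Real.sq_sqrt (show 0 ≤ 8 * ℓ by positivity)
  set u := √(8 * ℓ)
  have hu0 : 0 ≤ u := Real.sqrt_nonneg _
  -- This minimizes −sσu + σ²s², the Chernoff exponent after bounding Σc² by 2; its value is −u²/4 =
  -- −2ℓ.
  set s := u / (2 * σ) with hs
  have hsσ : s * σ = u / 2 := by rw [hs]; field_simp
  have side : ∀ ε : ℝ, |ε| = 1 →
      P {ω | σ * u ≤ ∑ p, ε * (c p * G ω p.1.1 p.1.2)} ≤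
        ENNReal.ofReal (Real.exp (-2 * ℓ)) := fun ε hε => by
    have hmgf : ∀ p : {p : Fin d × Fin d // p.1 ≤ p.2},
        mgf (fun ω => ε * (c p * G ω p.1.1 p.1.2)) P s =
          Real.exp (σ ^ 2 * s ^ 2 / 2 * c p ^ 2) := fun p => by
      have h1 := mgf_gaussianReal (hG.law p.1.1 p.1.2 p.2).map_eq (s * (ε * c p))
      have h2 : ε ^ 2 = 1 := by rw [← sq_abs, hε, one_pow]
      rw [zero_mul, zero_add, Real.coe_toNNReal _ (sq_nonneg σ)] at h1
      calc _ = mgf (fun ω => G ω p.1.1 p.1.2) P (s * (ε * c p)) := by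
            simp only [mgf]; congr 1; ext ω; congr 1; ring
        _ = _ := by
            rw [h1]; congr 1
            linear_combination (σ ^ 2 * s ^ 2 * c p ^ 2 / 2) * h2
    refine (measure_sum_ge_le_of_mgf_le (X := fun p ω => ε * (c p * G ω p.1.1 p.1.2))
      (hG.indep.comp (fun p v => ε * (c p * v)) fun _ => by fun_prop)
      (fun p => ((hG.law p.1.1 p.1.2 p.2).aemeasurable.const_mul _).const_mul _)
      (s := s) (by positivity) (fun p => ?_) (fun p => (hmgf p).le) _).trans ?_
    · by_contra h
      have h1 := hmgf p
      rw [mgf, integral_undef h] at h1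
      exact (Real.exp_pos _).ne h1
    · refine ENNReal.ofReal_le_ofReal (Real.exp_le_exp.2 ?_)
      rw [← Finset.mul_sum]
      have h1 : -s * (σ * u) = - (u ^ 2 / 2) := by linear_combination (-u) * hsσ
      have h2 : σ ^ 2 * s ^ 2 = u ^ 2 / 4 := by rw [← mul_pow, mul_comm, hsσ]; ring
      rw [h1, h2, hu]
      nlinarith
  have hsub : {ω | σ * u ≤ |qf (G ω) y|} ≤ᵐ[P]
      ({ω | σ * u ≤ ∑ p, (1 : ℝ) * (c p * G ω p.1.1 p.1.2)} ∪
      {ω | σ * u ≤ ∑ p, (-1 : ℝ) * (c p * G ω p.1.1 p.1.2)} : Set Ω) := by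
    filter_upwards [hqf] with ω hω h
    have h' : σ * u ≤ |qf (G ω) y| := h
    rw [hω] at h'
    rcases le_abs.1 h' with h | h
    · left; simpa using h
    · right; simpa using h
  refine (measure_mono_ae hsub).trans ((measure_union_le _ _).trans ?_)
  rw [two_mul, ENNReal.ofReal_add (Real.exp_pos _).le (Real.exp_pos _).le]
  exact add_le_add (side 1 (by simp)) (side (-1) (by simp))

end Tails

/-! ### Spectral norm and perturbation of inverses -/

section OperatorNorm

variable {d : ℕ}

lemma l2_opNorm_le_of_forall {M : Matrix (Fin d) (Fin d) ℝ} {c : ℝ} (hc : 0 ≤ c)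
    (h : ∀ x, (M *ᵥ x) ⬝ᵥ (M *ᵥ x) ≤ c ^ 2 * (x ⬝ᵥ x)) : ‖M‖ ≤ c := by
  rw [cstar_norm_def]
  refine ContinuousLinearMap.opNorm_le_bound _ hc fun x => ?_
  refine abs_le_of_sq_le_sq' ?_ (by positivity) |>.2
  have := h x.ofLp
  rwa [← norm_toLp_sq, ← norm_toLp_sq, ← mul_pow] at this

/-- Polarization at c·x ± Mx and the parallelogram identity give |Mx|² ≤ c²|x|², with no spectral
decomposition. -/
lemma l2_opNorm_le_of_abs_qf_le {M : Matrix (Fin d) (Fin d) ℝ} (hM : M.IsSymm) {c : ℝ}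
    (hc : 0 < c) (h : ∀ x, |qf M x| ≤ c * (x ⬝ᵥ x)) : ‖M‖ ≤ c := by
  refine l2_opNorm_le_of_forall hc.le fun x => ?_
  have hpol : qf M (c • x + M *ᵥ x) - qf M (c • x - M *ᵥ x) =
      4 * c * ((M *ᵥ x) ⬝ᵥ (M *ᵥ x)) := by
    have hs : x ⬝ᵥ (M *ᵥ (M *ᵥ x)) = (M *ᵥ x) ⬝ᵥ (M *ᵥ x) := by
      rw [dotProduct_mulVec, ← mulVec_transpose, hM.eq]
    simp only [qf, mulVec_add, mulVec_sub, mulVec_smul, add_dotProduct, sub_dotProduct,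
      dotProduct_add, dotProduct_sub, smul_dotProduct, dotProduct_smul, smul_eq_mul, hs]
    ring
  have h1 := (abs_le.1 (h (c • x + M *ᵥ x))).2
  have h2 := (abs_le.1 (h (c • x - M *ᵥ x))).1
  have h3 : (c • x + M *ᵥ x) ⬝ᵥ (c • x + M *ᵥ x) + (c • x - M *ᵥ x) ⬝ᵥ (c • x - M *ᵥ x) =
      2 * c ^ 2 * (x ⬝ᵥ x) + 2 * ((M *ᵥ x) ⬝ᵥ (M *ᵥ x)) := by
    simp only [add_dotProduct, sub_dotProduct, dotProduct_add, dotProduct_sub, smul_dotProduct,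
      dotProduct_smul, smul_eq_mul]
    ring
  nlinarith

lemma dotProduct_le_sqrt_mul_sqrt (x y : Fin d → ℝ) : |x ⬝ᵥ y| ≤ √(x ⬝ᵥ x) * √(y ⬝ᵥ y) := by
  rw [← norm_toLp_sq, ← norm_toLp_sq, Real.sqrt_sq (norm_nonneg _), Real.sqrt_sq (norm_nonneg _)]
  have := abs_real_inner_le_norm (WithLp.toLp 2 y : EuclideanSpace ℝ (Fin d)) (WithLp.toLp 2 x)
  simp only [EuclideanSpace.inner_eq_star_dotProduct, star_trivial] at this
  linarith

lemma abs_qf_le_l2_opNorm (M : Matrix (Fin d) (Fin d) ℝ) (x : Fin d → ℝ) :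
    |qf M x| ≤ ‖M‖ * (x ⬝ᵥ x) := by
  have h1 := l2_opNorm_mulVec M (WithLp.toLp 2 x)
  have h2 := dotProduct_le_sqrt_mul_sqrt x (M *ᵥ x)
  rw [← norm_toLp_sq, ← norm_toLp_sq, Real.sqrt_sq (norm_nonneg _),
    Real.sqrt_sq (norm_nonneg _)] at h2
  rw [← norm_toLp_sq, qf]
  refine h2.trans ?_
  have h3 : ‖(WithLp.toLp 2 (M *ᵥ x) : EuclideanSpace ℝ (Fin d))‖ ≤
    ‖M‖ * ‖(WithLp.toLp 2 x : EuclideanSpace ℝ (Fin d))‖ := h1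
  nlinarith [norm_nonneg (WithLp.toLp 2 x : EuclideanSpace ℝ (Fin d))]

/-- A coercive matrix is invertible, with a bound on the inverse. -/
lemma isUnit_and_norm_inv_le_of_coercive {W : Matrix (Fin d) (Fin d) ℝ} {D : ℝ} (hD : 0 < D)
    (h : ∀ x, D * (x ⬝ᵥ x) ≤ qf W x) : IsUnit W ∧ ‖W⁻¹‖ ≤ D⁻¹ := by
  have hu : IsUnit W := by
    refine mulVec_injective_iff_isUnit.1 ((injective_iff_map_eq_zero W.mulVecLin).2 fun x hx => ?_)
    have hx' : W *ᵥ x = 0 := hx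
    have h1 := h x
    rw [qf, hx', dotProduct_zero] at h1
    refine dotProduct_self_eq_zero.1 (le_antisymm ?_ (dotProduct_self_nonneg_real x))
    exact nonpos_of_mul_nonpos_right h1 hD
  refine ⟨hu, l2_opNorm_le_of_forall (inv_nonneg.2 hD.le) fun x => ?_⟩
  set y := W⁻¹ *ᵥ x with hy
  have hWy : W *ᵥ y = x := by
    rw [hy, mulVec_mulVec, mul_nonsing_inv _ ((isUnit_iff_isUnit_det W).1 hu), one_mulVec]
  have h1 := h y
  rw [qf, hWy] at h1
  have h4 := (le_abs_self _).trans (dotProduct_le_sqrt_mul_sqrt y x)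
  have hyy := Real.sq_sqrt (dotProduct_self_nonneg_real y)
  have hxx := Real.sq_sqrt (dotProduct_self_nonneg_real x)
  set a := √(y ⬝ᵥ y)
  set b := √(x ⬝ᵥ x)
  have ha : 0 ≤ a := Real.sqrt_nonneg _
  have hb : 0 ≤ b := Real.sqrt_nonneg _
  have hab : D * a ≤ b := by
    rcases ha.eq_or_lt with h0 | h0
    · rw [← h0, mul_zero]; exact hb
    · refine le_of_mul_le_mul_right ?_ h0
      nlinarith
  rw [← hyy, ← hxx, ← mul_pow]
  have : a ≤ D⁻¹ * b := by rwa [le_inv_mul_iff₀ hD]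
  gcongr

/-- The perturbed matrix keeps coercivity D/2, and the resolvent identity gives the difference as a
product of three factors. -/
lemma inv_add_sub_inv_le {W G : Matrix (Fin d) (Fin d) ℝ} {D : ℝ} (hD : 0 < D)
    (h : ∀ x, D * (x ⬝ᵥ x) ≤ qf W x) (hG : ‖G‖ ≤ D / 2) :
    IsUnit W ∧ IsUnit (W + G) ∧ ‖(W + G)⁻¹ - W⁻¹‖ ≤ 2 * ‖G‖ / D ^ 2 := by
  obtain ⟨hW, hWn⟩ := isUnit_and_norm_inv_le_of_coercive hD h
  obtain ⟨hWG, hWGn⟩ := isUnit_and_norm_inv_le_of_coercive (W := W + G) (half_pos hD) fun x => by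
    have h1 := abs_le.1 (abs_qf_le_l2_opNorm G x)
    have h2 := dotProduct_self_nonneg_real x
    rw [qf_add]
    nlinarith [h x]
  refine ⟨hW, hWG, ?_⟩
  rw [Matrix.inv_sub_inv (iff_of_true hWG hW), sub_add_cancel_left]
  calc ‖(W + G)⁻¹ * -G * W⁻¹‖ ≤ ‖(W + G)⁻¹‖ * ‖-G‖ * ‖W⁻¹‖ :=
        (l2_opNorm_mul _ _).trans (mul_le_mul_of_nonneg_right (l2_opNorm_mul _ _) (norm_nonneg _))
    _ ≤ (D / 2)⁻¹ * ‖G‖ * D⁻¹ := by rw [norm_neg]; gcongr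
    _ = 2 * ‖G‖ / D ^ 2 := by field_simp

lemma norm_invSqrtM_sq {A : Matrix (Fin d) (Fin d) ℝ} (hA : A.PosDef) :
    ‖invSqrtM A‖ * ‖invSqrtM A‖ = ‖A⁻¹‖ := by
  rw [← l2_opNorm_conjTranspose_mul_self, conjTranspose_eq_transpose_of_trivial,
    invSqrtM_transpose, invSqrtM_mul_self hA]

end OperatorNorm

/-! ### When truncation is inactive -/

section Truncation

variable {d n : ℕ}

lemma secondMoment_mulVec (T : Matrix (Fin d) (Fin d) ℝ) (x : Fin n → EuclideanSpace ℝ (Fin d)) :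
    secondMoment (fun i => WithLp.toLp 2 (T *ᵥ (x i).ofLp)) = T * secondMoment x * Tᵀ := by
  simp only [secondMoment, Matrix.mul_smul, Matrix.smul_mul, Matrix.mul_sum, Matrix.sum_mul,
    mul_vecMulVec, vecMulVec_mul, vecMul_transpose]

/-- If no point is truncated, the transformed second-moment matrix is a congruence of the
original one. -/
lemma regTransformed_eq_of_lt {τ η lam : ℝ} {A : Matrix (Fin d) (Fin d) ℝ} (hA : A.PosDef)
    {x : Fin n → EuclideanSpace ℝ (Fin d)}
    (h : ∀ i, qf A⁻¹ (x i).ofLp < τ * (d * (1 + Real.log (2 * n / η)))) :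
    regTransformed τ η lam A x = invSqrtM A * (secondMoment x + lam • 1) * invSqrtM A := by
  have hp : pmt τ η A x = fun i => WithLp.toLp 2 (invSqrtM A *ᵥ (x i).ofLp) := by
    funext i
    rw [pmt, truncate, if_neg]
    rw [not_le, pmtRadius]
    refine Real.lt_sqrt_of_sq_lt ?_
    rw [norm_toLp_sq, ← qf_inv hA]
    exact h i
  rw [regTransformed, hp, secondMoment_mulVec, invSqrtM_transpose, mul_add, add_mul,
    mul_smul_comm, mul_one, smul_mul_assoc, invSqrtM_mul_self hA]

lemma sqrtM_conj_invSqrtM_conj {A : Matrix (Fin d) (Fin d) ℝ} (hA : A.PosDef)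
    (M : Matrix (Fin d) (Fin d) ℝ) :
    sqrtM A * (invSqrtM A * M * invSqrtM A) * sqrtM A = M := by
  calc _ = (sqrtM A * invSqrtM A) * M * (invSqrtM A * sqrtM A) := by simp only [mul_assoc]
    _ = M := by rw [sqrtM_mul_invSqrtM hA, invSqrtM_mul_sqrtM hA, one_mul, mul_one]

/-- With w = A⁻¹x and q = qf A⁻¹ x, one has q = ⟨S^{-1/2}x, S^{1/2}w⟩. Cauchy–Schwarz gives q² ≤ qf
S⁻¹ x · c·q, and q is cancelled. If q = 0 then x = 0. -/
lemma qf_inv_le_of_qf_le {A S : Matrix (Fin d) (Fin d) ℝ} (hA : A.PosDef) (hS : S.PosDef) {c : ℝ}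
    (h : ∀ u, qf S u ≤ c * qf A u) (x : Fin d → ℝ) : qf A⁻¹ x ≤ c * qf S⁻¹ x := by
  set w := A⁻¹ *ᵥ x with hw
  have hAw : qf A w = qf A⁻¹ x := by
    rw [qf, hw, mulVec_mulVec, mul_nonsing_inv _ hA.det_pos.ne'.isUnit, one_mulVec, dotProduct_comm]
    rfl
  have h1 : qf A⁻¹ x = (invSqrtM S *ᵥ x) ⬝ᵥ (sqrtM S *ᵥ w) := by
    rw [dotProduct_mulVec, ← mulVec_transpose, sqrtM_transpose, mulVec_mulVec,
      sqrtM_mul_invSqrtM hS, one_mulVec, qf]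
  have h2 := h w
  rw [qf_eq_sqrtM hS.posSemidef, hAw] at h2
  have h3 := (le_abs_self _).trans
    (dotProduct_le_sqrt_mul_sqrt (invSqrtM S *ᵥ x) (sqrtM S *ᵥ w))
  rw [← h1, ← qf_inv hS] at h3
  have hp0 : 0 ≤ qf S⁻¹ x := by rw [qf_inv hS]; exact dotProduct_self_nonneg_real _
  have hq0 := dotProduct_self_nonneg_real (sqrtM S *ᵥ w)
  have hA0 : 0 ≤ qf A⁻¹ x := by rw [qf_inv hA]; exact dotProduct_self_nonneg_real _
  rw [← Real.sqrt_mul hp0] at h3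
  have h4 : qf A⁻¹ x ^ 2 ≤ qf S⁻¹ x * ((sqrtM S *ᵥ w) ⬝ᵥ (sqrtM S *ᵥ w)) := by
    rw [← Real.sq_sqrt (mul_nonneg hp0 hq0)]; gcongr
  rcases hA0.eq_or_lt with h0 | h0
  · rw [← h0] at h2 h4 ⊢
    by_contra! hneg
    rw [← h0] at hAw
    have hx : w = 0 := by
      by_contra hne
      have := hA.dotProduct_mulVec_pos hne
      simp only [star_trivial] at this
      exact absurd hAw this.ne'
    have hx0 : x = 0 := by
      have : A *ᵥ w = x := by
        rw [hw, mulVec_mulVec, mul_nonsing_inv _ hA.det_pos.ne'.isUnit, one_mulVec]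
      rw [← this, hx, mulVec_zero]
    simp [hx0, qf] at hneg
  · refine le_of_mul_le_mul_right ?_ h0
    nlinarith

end Truncation

/-! ### Coercivity and stability of the inverse -/

section Stability

variable {d n m : ℕ}

/-- The conditions Cδ ≤ 1 and 2c ≤ C force δ ≤ 1 and cδ ≤ 1/2. The first bound rules out truncation;
the second produces the factor `lowerL`. -/
lemma bounds_of_close_of_small {A S : Matrix (Fin d) (Fin d) ℝ} {c C δ : ℝ} (hc : 0 ≤ c)
    (hC1 : 1 ≤ C) (hcC : 2 * c ≤ C) (hδ : 0 ≤ δ) (hCδ : C * δ ≤ 1) (hS : ∀ u, 0 ≤ qf S u)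
    (h : ∀ u, |qf A u - qf S u| ≤ c * max δ (δ ^ 2) * qf S u) (u : Fin d → ℝ) :
    qf S u ≤ 2 * qf A u ∧ qf A u ≤ (1 + C * δ) ^ 2 * qf S u := by
  have hδ1 : δ ≤ 1 := by nlinarith
  have h1 := abs_le.1 (h u)
  rw [max_eq_left (by nlinarith)] at h1
  have h2 : c * δ ≤ 1 / 2 := by nlinarith
  have h3 : 1 + c * δ ≤ (1 + C * δ) ^ 2 := by
    have h4 : c * δ ≤ C * δ := by gcongr; linarith
    nlinarith [mul_nonneg hc hδ, sq_nonneg (C * δ)]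
  have h4 := hS u
  constructor
  · nlinarith
  · nlinarith

/-- Either the positive part is zero and only B ≥ 0 is needed, or δ ≤ 1 and (1 − Cδ)² ≤ 1 − cδ.
Clipping thus removes any size condition on the private sample. -/
lemma shrink_lower_bound_of_close {B S : Matrix (Fin d) (Fin d) ℝ} {c C δ : ℝ} (hc : 0 ≤ c)
    (hC1 : 1 ≤ C) (hcC : c ≤ C) (hδ : 0 ≤ δ) (hS : ∀ u, 0 ≤ qf S u) (hB : ∀ u, 0 ≤ qf B u)
    (h : ∀ u, |qf B u - qf S u| ≤ c * max δ (δ ^ 2) * qf S u) (u : Fin d → ℝ) :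
    max 0 (1 - C * δ) ^ 2 * qf S u ≤ qf B u := by
  rcases le_total (1 - C * δ) 0 with h0 | h0
  · rw [max_eq_left h0]; simpa using hB u
  · have hδ1 : δ ≤ 1 := by nlinarith
    have h1 := abs_le.1 (h u)
    rw [max_eq_left (by nlinarith)] at h1
    rw [max_eq_right h0]
    have h2 : c * δ ≤ C * δ := by gcongr
    have h3 : (1 - C * δ) ^ 2 ≤ 1 - c * δ := by nlinarith [mul_nonneg (hc.trans hcC) hδ]
    nlinarith [hS u]

lemma shrink_eq {C η : ℝ} (hη : 0 < η) (hη1 : η < 1) :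
    shrink C d n η = max 0 (1 - C * (devTerm d η / √(n : ℝ))) := by
  have hlog : 0 < Real.log (1 / η) := Real.log_pos (by rwa [lt_div_iff₀ hη, one_mul])
  rw [shrink, devTerm, Real.sqrt_div (Nat.cast_nonneg d), Real.sqrt_div hlog.le, add_div]

lemma lowerL_mul_sq {C η : ℝ} (hC : 0 ≤ C) (hm : 1 ≤ m) :
    lowerL C d m η * (1 + C * (devTerm d η / √(m : ℝ))) ^ 2 = 1 := by
  have hm0 : (0 : ℝ) < m := by exact_mod_cast hm
  have hs : 0 < √(m : ℝ) := Real.sqrt_pos.2 hm0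
  have hdev : 0 ≤ devTerm d η := by rw [devTerm]; positivity
  have h1 : 0 < √(m : ℝ) + C * devTerm d η := by positivity
  have h2 : 1 + C * (devTerm d η / √(m : ℝ)) = (√(m : ℝ) + C * devTerm d η) / √(m : ℝ) := by
    field_simp
  rw [lowerL, h2, div_pow, Real.sq_sqrt hm0.le]
  field_simp

/-- For v = A^{-1/2}x, |x|² = qf A v is bounded both by (1 + Cδ)² qf S v and by ‖A‖|v|²; each bound
yields one summand. -/
lemma stabDenom_mul_le_qf {C η lam : ℝ} {A B S : Matrix (Fin d) (Fin d) ℝ} (hA : A.PosDef)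
    (hC : 0 ≤ C) (hm : 1 ≤ m) (hlam : 0 ≤ lam)
    (hup : ∀ u, qf A u ≤ (1 + C * (devTerm d η / √(m : ℝ))) ^ 2 * qf S u)
    (hlow : ∀ u, shrink C d n η ^ 2 * qf S u ≤ qf B u) (x : Fin d → ℝ) :
    stabDenom C n m η lam A * (x ⬝ᵥ x) ≤ qf (invSqrtM A * (B + lam • 1) * invSqrtM A) x := by
  rw [qf_conj (invSqrtM_transpose A), qf_add, qf_smul_left, qf_one, stabDenom, add_mul]
  set v := invSqrtM A *ᵥ x with hv
  have hxx : qf A v = x ⬝ᵥ x := by rw [hv, qf_invSqrtM hA]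
  have hL0 : 0 ≤ lowerL C d m η := by rw [lowerL]; positivity
  refine add_le_add ?_ ?_
  · refine le_trans ?_ (hlow v)
    calc lowerL C d m η * shrink C d n η ^ 2 * (x ⬝ᵥ x)
        ≤ lowerL C d m η * shrink C d n η ^ 2 *
          ((1 + C * (devTerm d η / √(m : ℝ))) ^ 2 * qf S v) := by
          rw [← hxx]
          exact mul_le_mul_of_nonneg_left (hup v) (by positivity)
      _ = (lowerL C d m η * (1 + C * (devTerm d η / √(m : ℝ))) ^ 2) *
          (shrink C d n η ^ 2 * qf S v) := by ring
      _ = shrink C d n η ^ 2 * qf S v := by rw [lowerL_mul_sq hC hm, one_mul]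
  · rw [mul_assoc]
    refine mul_le_mul_of_nonneg_left ?_ hlam
    rcases (norm_nonneg A).eq_or_lt with h0 | h0
    · rw [← h0, _root_.inv_zero, zero_mul]; exact dotProduct_self_nonneg_real v
    · rw [inv_mul_le_iff₀ h0, ← hxx]
      exact (le_abs_self _).trans (abs_qf_le_l2_opNorm A v)

/-- The two denominators are (a + b)² and a² + b² with a, b ≥ 0, comparable up to a factor 2. The
constant 32 is twice the 16 of the Gaussian bound. -/
lemma stable_inverse_bound {C τ η μ lam : ℝ} {A W G : Matrix (Fin d) (Fin d) ℝ} (hC : 32 ≤ C)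
    (hτ : 0 ≤ τ) (hr : 0 ≤ noiseRate d n η μ) (hlam : 0 ≤ lam)
    (hst : StableCond C τ n m η μ lam A)
    (hW : ∀ x, stabDenom C n m η lam A * (x ⬝ᵥ x) ≤ qf W x)
    (hG : ‖G‖ ≤ 16 * τ * noiseRate d n η μ) :
    IsUnit W ∧ IsUnit (W + G) ∧
      ‖(W + G)⁻¹ - W⁻¹‖ ≤ C * τ * noiseRate d n η μ / errDenom C n m η lam A := by
  obtain ⟨hD, hr2⟩ := hst
  rw [div_le_iff₀ hD] at hr2
  have hτr : 0 ≤ τ * noiseRate d n η μ := mul_nonneg hτ hr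
  have h1 : 32 * (τ * noiseRate d n η μ) ≤ C * (τ * noiseRate d n η μ) := by gcongr
  obtain ⟨hW1, hW2, hn⟩ := inv_add_sub_inv_le hD hW (G := G) (by linarith)
  refine ⟨hW1, hW2, hn.trans ?_⟩
  have hL0 : 0 ≤ lowerL C d m η * shrink C d n η ^ 2 := by rw [lowerL]; positivity
  have hl0 : 0 ≤ lam * ‖A‖⁻¹ := by positivity
  have herr : errDenom C n m η lam A =
      (lowerL C d m η * shrink C d n η ^ 2) ^ 2 + (lam * ‖A‖⁻¹) ^ 2 := by rw [errDenom]; ring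
  have hle : errDenom C n m η lam A ≤ stabDenom C n m η lam A ^ 2 := by
    rw [herr, stabDenom]; nlinarith [mul_nonneg hL0 hl0]
  have hpos : 0 < errDenom C n m η lam A := by
    have h2 : stabDenom C n m η lam A ^ 2 ≤ 2 * errDenom C n m η lam A := by
      rw [herr, stabDenom]; exact add_sq_le
    have := pow_pos hD 2
    linarith
  calc 2 * ‖G‖ / stabDenom C n m η lam A ^ 2
      ≤ C * τ * noiseRate d n η μ / stabDenom C n m η lam A ^ 2 := by
        refine div_le_div_of_nonneg_right ?_ (sq_nonneg _)
        linarith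
    _ ≤ C * τ * noiseRate d n η μ / errDenom C n m η lam A := by
        rw [mul_assoc]
        have : 0 ≤ C * (τ * noiseRate d n η μ) := by linarith
        gcongr

lemma conj_inverse_bound {A M W N : Matrix (Fin d) (Fin d) ℝ} {ε : ℝ} (hA : A.PosDef)
    (hW : W = invSqrtM A * M * invSqrtM A) (hu : IsUnit W) (h : ‖N⁻¹ - W⁻¹‖ ≤ ε) :
    IsUnit M ∧ ‖invSqrtM A * N⁻¹ * invSqrtM A - M⁻¹‖ ≤ ε * ‖A⁻¹‖ := by
  have hM : M = sqrtM A * W * sqrtM A := by rw [hW, sqrtM_conj_invSqrtM_conj hA]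
  have hQ : IsUnit (sqrtM A) := (isUnit_iff_isUnit_det _).2 (isUnit_det_sqrtM hA)
  refine ⟨hM ▸ (hQ.mul hu).mul hQ, ?_⟩
  have hMi : M⁻¹ = invSqrtM A * W⁻¹ * invSqrtM A := by
    rw [hM, Matrix.mul_inv_rev, Matrix.mul_inv_rev, invSqrtM, mul_assoc]
  rw [hMi, ← sub_mul, ← mul_sub]
  calc _ ≤ ‖invSqrtM A‖ * ‖N⁻¹ - W⁻¹‖ * ‖invSqrtM A‖ :=
        (l2_opNorm_mul _ _).trans (mul_le_mul_of_nonneg_right (l2_opNorm_mul _ _) (norm_nonneg _))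
    _ = ‖N⁻¹ - W⁻¹‖ * ‖A⁻¹‖ := by rw [← norm_invSqrtM_sq hA]; ring
    _ ≤ ε * ‖A⁻¹‖ := by gcongr

/-- As log 2 ≥ 1/2, d + log(1/η) ≤ 2d·log(2d/η). The leading 2 is the net's loss. -/
lemma gaussian_threshold_le {τ η μ : ℝ} (hd : 1 ≤ d) (hn : 1 ≤ n) (hη : 0 < η) (hη1 : η < 1)
    (hμ : 0 < μ) (hτ : 0 ≤ τ) :
    2 * (noiseScale τ d n η μ * √(8 * (d + Real.log (1 / η)))) ≤
      16 * τ * noiseRate d n η μ := by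
  have hd0 : (1 : ℝ) ≤ d := by exact_mod_cast hd
  have hn0 : (1 : ℝ) ≤ n := by exact_mod_cast hn
  have hlog : 0 < Real.log (1 / η) := Real.log_pos (by rwa [lt_div_iff₀ hη, one_mul])
  have hlogn : 0 < Real.log (2 * n / η) := Real.log_pos (by rw [lt_div_iff₀ hη]; linarith)
  have hlogd : Real.log 2 + Real.log (1 / η) ≤ Real.log (2 * d / η) := by
    rw [← Real.log_mul two_ne_zero (by positivity)]
    refine Real.log_le_log (by positivity) ?_
    rw [mul_one_div]; gcongr; linarith
  have h2 : (1 : ℝ) / 2 ≤ Real.log 2 := by linarith [Real.log_two_gt_d9]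
  have hsq : √(8 * (d + Real.log (1 / η))) ≤ 4 * √(d * Real.log (2 * d / η)) := by
    rw [show (4 : ℝ) = √16 by rw [show (16 : ℝ) = 4 ^ 2 by norm_num]; simp,
      ← Real.sqrt_mul (by norm_num)]
    refine Real.sqrt_le_sqrt ?_
    nlinarith
  have hrate : noiseRate d n η μ =
      d * √(d * Real.log (2 * d / η)) * (1 + Real.log (2 * n / η)) / (μ * n) := by
    rw [noiseRate, show (d : ℝ) ^ 3 * Real.log (2 * d / η) =
      (d : ℝ) ^ 2 * (d * Real.log (2 * d / η)) by ring, Real.sqrt_mul (by positivity),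
      Real.sqrt_sq (by positivity)]
  have hσ : 0 ≤ noiseScale τ d n η μ := by rw [noiseScale]; positivity
  calc 2 * (noiseScale τ d n η μ * √(8 * (d + Real.log (1 / η))))
      ≤ 2 * (noiseScale τ d n η μ * (4 * √(d * Real.log (2 * d / η)))) := by gcongr
    _ = 16 * τ * noiseRate d n η μ := by rw [hrate, noiseScale]; ring

end Stability

/-! ### Assembly of the good events -/

theorem theorem3p4 (K : ℝ) (hK : 0 < K) :
    ∃ C : ℝ, 0 < C ∧
      ∀ (d nξ nυ : ℕ) (η lam τ : ℝ) (S : Matrix (Fin d) (Fin d) ℝ)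
        (Ω : Type u) [MeasurableSpace Ω] (P : Measure Ω) [IsProbabilityMeasure P]
        (ξ : Fin nξ → Ω → EuclideanSpace ℝ (Fin d)) (υ : Fin nυ → Ω → EuclideanSpace ℝ (Fin d)),
        1 ≤ d → 1 ≤ nξ → 0 < η → η < 1 → 0 ≤ lam → C ≤ τ → S.PosDef →
        IsIIDSubG P K S ξ → IsIIDSubG P K S υ →
        C * devTerm d η ≤ √(nυ : ℝ) →
        -- Recovery
        P {ω | ¬ ((secondMoment (υ · ω)).PosDef ∧
            sqrtM (secondMoment (υ · ω)) *
                regTransformed τ η lam (secondMoment (υ · ω)) (ξ · ω) *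
                sqrtM (secondMoment (υ · ω)) =
              secondMoment (ξ · ω) + lam • 1)} ≤ ENNReal.ofReal (C * η) ∧
        ∀ (μ : ℝ) (G : Ω → Matrix (Fin d) (Fin d) ℝ), 0 < μ →
          IsSymmGaussian P (noiseScale τ d nξ η μ) G →
          -- Inverse error in the transformed space
          P {ω | StableCond C τ nξ nυ η μ lam (secondMoment (υ · ω)) ∧
            ¬ ((secondMoment (υ · ω)).PosDef ∧
              IsUnit (regTransformed τ η lam (secondMoment (υ · ω)) (ξ · ω)) ∧
              IsUnit (regTransformed τ η lam (secondMoment (υ · ω)) (ξ · ω) + G ω) ∧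
              ‖(regTransformed τ η lam (secondMoment (υ · ω)) (ξ · ω) + G ω)⁻¹ -
                  (regTransformed τ η lam (secondMoment (υ · ω)) (ξ · ω))⁻¹‖ ≤
                C * τ * noiseRate d nξ η μ /
                  errDenom C nξ nυ η lam (secondMoment (υ · ω)))} ≤ ENNReal.ofReal (C * η) ∧
          -- Inverse error in the original space
          P {ω | StableCond C τ nξ nυ η μ lam (secondMoment (υ · ω)) ∧
            ¬ ((secondMoment (υ · ω)).PosDef ∧
              IsUnit (secondMoment (ξ · ω) + lam • (1 : Matrix (Fin d) (Fin d) ℝ)) ∧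
              IsUnit (regTransformed τ η lam (secondMoment (υ · ω)) (ξ · ω) + G ω) ∧
              ‖invSqrtM (secondMoment (υ · ω)) *
                    (regTransformed τ η lam (secondMoment (υ · ω)) (ξ · ω) + G ω)⁻¹ *
                    invSqrtM (secondMoment (υ · ω)) -
                  (secondMoment (ξ · ω) + lam • (1 : Matrix (Fin d) (Fin d) ℝ))⁻¹‖ ≤
                C * τ * noiseRate d nξ η μ * ‖(secondMoment (υ · ω))⁻¹‖ /
                  errDenom C nξ nυ η lam (secondMoment (υ · ω)))} ≤ ENNReal.ofReal (C * η) := by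
  -- Any C with C ≥ 32, C ≥ 2·112K² and C ≥ 7 works: these serve the inverse bound, the
  -- second-moment comparison and the failure probability (2 + 2 + 1 + 2)η. The bound 2K² ≤ τ
  -- follows too.
  refine ⟨64 + 448 * K ^ 2, by positivity, ?_⟩
  intro d n m η lam τ S Ω _ P _ ξ υ hd hn hη hη1 hlam hCτ hS hξ hυ hdev
  set C : ℝ := 64 + 448 * K ^ 2 with hC
  have hK2 : 0 < K ^ 2 := by positivity
  have hd0 : (1 : ℝ) ≤ d := by exact_mod_cast hd
  have hn0 : (1 : ℝ) ≤ n := by exact_mod_cast hn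
  have hτ : 0 < τ := by linarith
  have hlogn : 0 < Real.log (2 * n / η) := Real.log_pos (by rw [lt_div_iff₀ hη]; linarith)
  have hlog : 0 < Real.log (1 / η) := Real.log_pos (by rwa [lt_div_iff₀ hη, one_mul])
  have hdev1 : 1 ≤ devTerm d η := by
    rw [devTerm]
    linarith [Real.one_le_sqrt.2 hd0, Real.sqrt_nonneg (Real.log (1 / η))]
  have hsm : 0 < √(m : ℝ) := lt_of_lt_of_le (by positivity) hdev
  have hm : 1 ≤ m := by exact_mod_cast Real.sqrt_pos.1 hsm
  have hSnn : ∀ u, 0 ≤ qf S u := fun u => by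
    rw [qf_eq_sqrtM hS.posSemidef]; exact dotProduct_self_nonneg_real _
  have hδm : C * (devTerm d η / √(m : ℝ)) ≤ 1 := by
    rw [← mul_div_assoc, div_le_one hsm]; exact hdev
  let badPub : Set Ω := {ω | ¬ ∀ u, |qf (secondMoment (υ · ω)) u - qf S u| ≤
    112 * K ^ 2 * max (devTerm d η / √(m : ℝ)) ((devTerm d η / √(m : ℝ)) ^ 2) * qf S u}
  let badPriv : Set Ω := {ω | ¬ ∀ u, |qf (secondMoment (ξ · ω)) u - qf S u| ≤
    112 * K ^ 2 * max (devTerm d η / √(n : ℝ)) ((devTerm d η / √(n : ℝ)) ^ 2) * qf S u}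
  let badNorm : Set Ω := {ω | ∃ i, d * K ^ 2 * Real.log (2 * n / η) ≤ qf S⁻¹ (ξ i ω).ofLp}
  have hPub : P badPub ≤ ENNReal.ofReal (2 * η) :=
    measure_not_secondMoment_close hK hS hυ hm hη hη1 rfl
  have hPriv : P badPriv ≤ ENNReal.ofReal (2 * η) :=
    measure_not_secondMoment_close hK hS hξ hn hη hη1 rfl
  have hNorm : P badNorm ≤ ENNReal.ofReal η :=
    measure_exists_le_qf_inv hK hS hξ.subG hd hn hη
  have hbounds : ∀ ω, ω ∉ badPub → ∀ u, qf S u ≤ 2 * qf (secondMoment (υ · ω)) u ∧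
      qf (secondMoment (υ · ω)) u ≤ (1 + C * (devTerm d η / √(m : ℝ))) ^ 2 * qf S u :=
    fun ω hω => bounds_of_close_of_small (by positivity) (by linarith) (by linarith)
      (by positivity) hδm hSnn (not_not.1 hω)
  have hpos : ∀ ω, ω ∉ badPub → (secondMoment (υ · ω)).PosDef := fun ω hω =>
    PosDef.of_dotProduct_mulVec_pos (isHermitian_secondMoment _) fun x hx => by
      have h1 := hS.dotProduct_mulVec_pos hx
      have h2 := (hbounds ω hω x).1
      simp only [star_trivial, qf] at h1 h2 ⊢
      linarith
  have hreg : ∀ ω, ω ∉ badPub → ω ∉ badNorm →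
      regTransformed τ η lam (secondMoment (υ · ω)) (ξ · ω) =
        invSqrtM (secondMoment (υ · ω)) * (secondMoment (ξ · ω) + lam • 1) *
          invSqrtM (secondMoment (υ · ω)) := fun ω h1 h2 =>
    regTransformed_eq_of_lt (hpos ω h1) fun i => by
      have h3 := qf_inv_le_of_qf_le (hpos ω h1) hS (fun u => (hbounds ω h1 u).1) (ξ i ω).ofLp
      have h4 : qf S⁻¹ (ξ i ω).ofLp < d * K ^ 2 * Real.log (2 * n / η) :=
        not_le.1 fun h => h2 ⟨i, h⟩
      calc _ ≤ 2 * qf S⁻¹ (ξ i ω).ofLp := h3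
        _ < 2 * K ^ 2 * (d * Real.log (2 * n / η)) := by linarith
        _ ≤ τ * (d * (1 + Real.log (2 * n / η))) := by
          gcongr <;> linarith
  refine ⟨?_, fun μ G hμ hG => ?_⟩
  · have hsub : {ω | ¬ ((secondMoment (υ · ω)).PosDef ∧
            sqrtM (secondMoment (υ · ω)) *
                regTransformed τ η lam (secondMoment (υ · ω)) (ξ · ω) *
                sqrtM (secondMoment (υ · ω)) =
              secondMoment (ξ · ω) + lam • 1)} ⊆ badPub ∪ badNorm := fun ω hω => by
      by_contra hcon
      rw [Set.mem_union, not_or] at hcon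
      refine hω ⟨hpos ω hcon.1, ?_⟩
      rw [hreg ω hcon.1 hcon.2, sqrtM_conj_invSqrtM_conj (hpos ω hcon.1)]
    refine (measure_mono hsub).trans ((measure_union_le _ _).trans
      ((add_le_add hPub hNorm).trans ?_))
    rw [← ENNReal.ofReal_add (by positivity) hη.le]
    exact ENNReal.ofReal_le_ofReal (by nlinarith)
  · have hσ : 0 < noiseScale τ d n η μ := by rw [noiseScale]; positivity
    have hr : 0 ≤ noiseRate d n η μ := by rw [noiseRate]; positivity
    set t := noiseScale τ d n η μ * √(8 * (d + Real.log (1 / η))) with ht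
    let badSymm : Set Ω := {ω | ¬ (G ω).IsSymm}
    let badGauss : Set Ω := {ω | ¬ ∀ x, |qf (G ω) x| ≤ 2 * t * (x ⬝ᵥ x)}
    have hSymm : P badSymm = 0 := hG.symm
    have hGauss : P badGauss ≤ ENNReal.ofReal (2 * η) :=
      measure_not_forall_abs_qf_le hη.le fun y hy => by
        refine (hG.measure_le_abs_qf hσ (ℓ := d + Real.log (1 / η)) (by positivity) hy).trans ?_
        refine ENNReal.ofReal_le_ofReal (mul_le_mul_of_nonneg_left ?_ two_pos.le)
        exact exp_neg_devTerm_le hη hη1 le_rfl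
    have hGn : ∀ ω, ω ∉ badSymm → ω ∉ badGauss → ‖G ω‖ ≤ 16 * τ * noiseRate d n η μ :=
      fun ω h1 h2 => (l2_opNorm_le_of_abs_qf_le (not_not.1 h1) (by positivity)
        (not_not.1 h2)).trans (gaussian_threshold_le hd hn hη hη1 hμ hτ.le)
    have hcoer : ∀ ω, ω ∉ badPub → ω ∉ badPriv → ω ∉ badNorm → ∀ x,
        stabDenom C n m η lam (secondMoment (υ · ω)) * (x ⬝ᵥ x) ≤
          qf (regTransformed τ η lam (secondMoment (υ · ω)) (ξ · ω)) x := fun ω h1 h2 h3 x => by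
      rw [hreg ω h1 h3]
      refine stabDenom_mul_le_qf (hpos ω h1) (by positivity) hm hlam
        (fun u => (hbounds ω h1 u).2) (fun u => ?_) x
      rw [shrink_eq hη hη1]
      refine shrink_lower_bound_of_close (c := 112 * K ^ 2) (by positivity) (by linarith)
        (by linarith) (by positivity) hSnn (fun u => ?_) (not_not.1 h2) u
      rw [qf_secondMoment]; positivity
    have hbad : P (badPub ∪ badPriv ∪ badNorm ∪ badGauss ∪ badSymm) ≤ ENNReal.ofReal (C * η) := by
      refine (measure_union_le _ _).trans ?_
      rw [hSymm, add_zero]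
      refine (measure_union_le _ _).trans (le_trans (add_le_add ((measure_union_le _ _).trans
        (add_le_add ((measure_union_le _ _).trans (add_le_add hPub hPriv)) hNorm)) hGauss) ?_)
      rw [← ENNReal.ofReal_add (by positivity) (by positivity),
        ← ENNReal.ofReal_add (by positivity) hη.le,
        ← ENNReal.ofReal_add (by positivity) (by positivity)]
      exact ENNReal.ofReal_le_ofReal (by nlinarith)
    have hmain : ∀ ω, ω ∉ badPub ∪ badPriv ∪ badNorm ∪ badGauss ∪ badSymm →
        StableCond C τ n m η μ lam (secondMoment (υ · ω)) → _ := fun ω hω hst => by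
      simp only [Set.mem_union, not_or] at hω
      obtain ⟨⟨⟨⟨h1, h2⟩, h3⟩, h4⟩, h5⟩ := hω
      exact stable_inverse_bound (by linarith) hτ.le hr hlam hst (hcoer ω h1 h2 h3) (hGn ω h5 h4)
    have hgood : ∀ ω, ω ∉ badPub ∪ badPriv ∪ badNorm ∪ badGauss ∪ badSymm →
        ω ∉ badPub ∧ ω ∉ badNorm := fun ω hω => by
      simp only [Set.mem_union, not_or] at hω
      exact ⟨hω.1.1.1.1, hω.1.1.2⟩
    refine ⟨(measure_mono fun ω hω => ?_).trans hbad, (measure_mono fun ω hω => ?_).trans hbad⟩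
    · by_contra hcon
      exact hω.2 ⟨hpos ω (hgood ω hcon).1, hmain ω hcon hω.1⟩
    · by_contra hcon
      have hA := hpos ω (hgood ω hcon).1
      obtain ⟨hW, hWG, hbd⟩ := hmain ω hcon hω.1
      obtain ⟨hM, hbd'⟩ := conj_inverse_bound hA (hreg ω (hgood ω hcon).1 (hgood ω hcon).2) hW hbd
      refine hω.2 ⟨hA, hM, hWG, hbd'.trans_eq ?_⟩
      ring
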